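/- Let $n\ge 1$ be odd, let $D_n=\langle x,y\mid x^n=y^2=1,\ yx=x^{-1}y\rangle$ be the dihedral group of order $2n$, and let $H=\langle y\rangle$. Let $E_HD_n=(D_n/H)^{*\infty}$ be the infinite join of copies of the finite discrete $D_n$-set $D_n/H$, with the colimit topology of the finite joins and the diagonal action of $D_n$. Let $\mathcal{M}$ be a coefficient system for $D_n$, that is, a contravariant functor from the orbit category of $D_n$ (objects the orbits $D_n/K$, morphisms the equivariant maps) to abelian groups. Let $\mathcal{M}^e$ be the $D_n$-module $\mathcal{M}(D_n/e)$, on which $g\in D_n$ acts by $\mathcal{M}$ applied to the right translation by $g$. The Bredon cohomology $H^*_{D_n}(X;\mathcal{M})$ of a $D_n$-space $X$ is the cohomology of the cochain complex $\mathrm{Hom}(\underline{C}_*(X),\mathcal{M})$ of homomorphisms of coefficient systems, where $\underline{C}_*(X)(D_n/K)=C_*(X^K;\mathbb{Z})$ is the singular chain complex of the fixed point space. (1) There are homomorphisms $H^i_{D_n}(E_HD_n;\mathcal{M})\to H^i(D_n;\mathcal{M}^e)$ for $i\ge 2$ and $H^i(H;\mathcal{M}^e)\to H^{i+1}_{D_n}(E_HD_n;\mathcal{M})$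 for $i\ge 1$, an abelian group $A$, and homomorphisms $H^0(H;\mathcal{M}^e)\to A$ and $A\to H^1(D_n;\mathcal{M}^e)$ such that the sequence $$0\to H^0(D_n;\mathcal{M}^e)\to H^0(H;\mathcal{M}^e)\to A\to H^1(D_n;\mathcal{M}^e)\to H^1(H;\mathcal{M}^e)\to H^2_{D_n}(E_HD_n;\mathcal{M})\to\cdots$$ $$\cdots\to H^i_{D_n}(E_HD_n;\mathcal{M})\to H^i(D_n;\mathcal{M}^e)\to H^i(H;\mathcal{M}^e)\to H^{i+1}_{D_n}(E_HD_n;\mathcal{M})\to\cdots\qquad(i\ge 2)$$ is exact, where the maps $H^i(D_n;\mathcal{M}^e)\to H^i(H;\mathcal{M}^e)$ are the restriction maps in group cohomology. Moreover, for the same group $A$ there is a surjective homomorphism $A\to H^1_{D_n}(E_HD_n;\mathcal{M})$. (2) Let $m$ be a positive integer relatively prime to $2n$, and suppose that $\mathcal{M}^e$ is $m$-profinite, that is, the abelian group $\mathcal{M}^e$ is the limit of an inverse system, indexed by a directed set, of abelian torsion groups in which the order of every element is a product of primes dividing $m$. Then $H^i_{D_n}(E_HD_n;\mathcal{M})=0$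 for all $i>1$. -/

import Mathlib

open CategoryTheory CategoryTheory.Limits

noncomputable section

/-! ### The orbit category and coefficient systems -/

/-- The orbit category of a group `G`. The object `⟨K⟩` stands for the orbit `G/K`; the morphisms
`G/K ⟶ G/L` are the `G`-equivariant maps. -/
structure OrbitCat (G : Type) [Group G] where
  /-- The subgroup `K` of the orbit `G/K`. -/
  sub : Subgroup G

instance (G : Type) [Group G] : Category (OrbitCat G) where
  Hom K L := (G ⧸ K.sub) →[G] (G ⧸ L.sub)
  id K := MulActionHom.id G
  comp f g := g.comp f

/-- A coefficient system: a contravariant functor from the orbit category to abelian groups. -/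
abbrev CoeffSystem (G : Type) [Group G] := (OrbitCat G)ᵒᵖ ⥤ ModuleCat.{0} ℤ

/-- Right translation `x ↦ x g`, as an endomorphism of the orbit `G/e`. -/
def rightTranslation {G : Type} [Group G] (g : G) :
    (⟨⊥⟩ : OrbitCat G) ⟶ ⟨⊥⟩ :=
  show (G ⧸ (⊥ : Subgroup G)) →[G] (G ⧸ (⊥ : Subgroup G)) from
  { toFun := Quotient.map' (fun x => x * g) (by
      intro a b h
      rw [QuotientGroup.leftRel_apply, Subgroup.mem_bot] at h ⊢
      have : a = b := inv_mul_eq_one.mp h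
      simp [this])
    map_smul' := by
      intro a x
      induction x using Quotient.inductionOn' with
      | h x =>
        change (Quotient.mk'' _ : G ⧸ (⊥ : Subgroup G)) = Quotient.mk'' _
        simp [mul_assoc] }

theorem rightTranslation_one {G : Type} [Group G] :
    rightTranslation (1 : G) = 𝟙 (⟨⊥⟩ : OrbitCat G) := by
  refine MulActionHom.ext fun x => ?_
  induction x using Quotient.inductionOn' with
  | h x =>
    change (Quotient.mk'' (x * 1) : G ⧸ (⊥ : Subgroup G)) = Quotient.mk'' x
    simp

theorem rightTranslation_mul {G : Type} [Group G] (g h : G) :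
    rightTranslation (g * h) = rightTranslation g ≫ rightTranslation h := by
  refine MulActionHom.ext fun x => ?_
  induction x using Quotient.inductionOn' with
  | h x =>
    change (Quotient.mk'' (x * (g * h)) : G ⧸ (⊥ : Subgroup G)) = Quotient.mk'' (x * g * h)
    simp [mul_assoc]

/-- The `G`-module `M^e = M(G/e)` of a coefficient system `M`: an element `g` acts by the map which
`M` assigns to the right translation by `g`. -/
def CoeffSystem.atE {G : Type} [Group G] (M : CoeffSystem G) : Rep.{0} ℤ G :=
  Rep.of (X := M.obj (Opposite.op ⟨⊥⟩))
    { toFun := fun g => (M.map (rightTranslation g).op).hom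
      map_one' := by
        rw [rightTranslation_one, op_id, M.map_id]
        rfl
      map_mul' := fun g h => by
        rw [rightTranslation_mul, op_comp, M.map_comp]
        rfl }

/-! ### Bredon cohomology -/

section Bredon

variable {G : Type} [Group G] (X : Type) [MulAction G X]

/-- For `x` in `X^L`, the `G`-map `G/L → X` which sends `gL` to `g • x`. -/
def orbitMap {L : Subgroup G} (x : MulAction.fixedPoints L X) : (G ⧸ L) → X :=
  Quotient.lift (fun g : G => g • (x : X)) (by
    intro a b h
    have h' : a⁻¹ * b ∈ L := QuotientGroup.leftRel_apply.mp h
    have h2 : (a⁻¹ * b) • (x : X) = x := x.2 ⟨_, h'⟩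
    calc a • (x : X) = a • ((a⁻¹ * b) • (x : X)) := by rw [h2]
      _ = b • (x : X) := by rw [smul_smul]; simp)

theorem orbitMap_smul {L : Subgroup G} (x : MulAction.fixedPoints L X) (g : G) (y : G ⧸ L) :
    orbitMap X x (g • y) = g • orbitMap X x y := by
  induction y using Quotient.inductionOn' with
  | h y => exact mul_smul g y (x : X)

variable [TopologicalSpace X] [ContinuousConstSMul G X]

/-- The map `X^L → X^K` induced by a `G`-map `φ : G/K → G/L`. If `φ (eK) = gL`, it sends `x` to
`g • x`. -/
def fixedPointsMap {K L : OrbitCat G} (φ : K ⟶ L) :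
    C(MulAction.fixedPoints L.sub X, MulAction.fixedPoints K.sub X) where
  toFun x := ⟨orbitMap X x (MulActionHom.toFun φ ((1 : G) : G ⧸ K.sub)), fun k => by
    have h := MulActionHom.map_smul' φ (k : G) ((1 : G) : G ⧸ K.sub)
    have hk : (k : G) • ((1 : G) : G ⧸ K.sub) = ((1 : G) : G ⧸ K.sub) := by
      rw [MulAction.Quotient.smul_coe, QuotientGroup.eq]
      simp
    rw [hk] at h
    change (k : G) • orbitMap X x _ = _
    rw [← orbitMap_smul]
    exact congrArg _ h.symm⟩
  continuous_toFun := by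
    refine Continuous.subtype_mk ?_ _
    obtain ⟨g, hg⟩ := QuotientGroup.mk_surjective (MulActionHom.toFun φ ((1 : G) : G ⧸ K.sub))
    rw [← hg]
    exact (continuous_const_smul g).comp continuous_subtype_val

/-- The functor `G/K ↦ X^K` from the opposite of the orbit category to topological spaces. -/
def fixedPointsFunctor : (OrbitCat G)ᵒᵖ ⥤ TopCat.{0} where
  obj K := TopCat.of (MulAction.fixedPoints K.unop.sub X)
  map φ := TopCat.ofHom (fixedPointsMap X φ.unop)
  map_id K := by
    ext x
    exact one_smul G (x : X)
  map_comp {K L P} φ ψ := by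
    ext x
    change orbitMap X x (MulActionHom.toFun φ.unop (MulActionHom.toFun ψ.unop _)) =
      orbitMap X (fixedPointsMap X φ.unop x) (MulActionHom.toFun ψ.unop _)
    generalize MulActionHom.toFun ψ.unop _ = y
    induction y using Quotient.inductionOn' with
    | h g =>
      have h := MulActionHom.map_smul' φ.unop g ((1 : G) : G ⧸ L.unop.sub)
      have hg : g • ((1 : G) : G ⧸ L.unop.sub) = (Quotient.mk'' g : G ⧸ L.unop.sub) := by
        rw [MulAction.Quotient.smul_coe]
        simp
      rw [hg] at h
      refine (congrArg (orbitMap X x) h).trans ?_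
      exact orbitMap_smul X x g _

/-- The integral singular chain complexes `C_*(X^K; ℤ)`, as a functor of `G/K`. -/
def singularChainsFunctor : (OrbitCat G)ᵒᵖ ⥤ ChainComplex (ModuleCat.{0} ℤ) ℕ :=
  fixedPointsFunctor X ⋙
    (AlgebraicTopology.singularChainComplexFunctor (ModuleCat.{0} ℤ)).obj (ModuleCat.of ℤ ℤ)

/-- The chain complex of coefficient systems `C_n(X)(G/K) = C_n(X^K; ℤ)`. -/
def bredonChains : ChainComplex (CoeffSystem G) ℕ where
  X n := singularChainsFunctor X ⋙ HomologicalComplex.eval _ _ n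
  d i j :=
    { app := fun K => ((singularChainsFunctor X).obj K).d i j
      naturality := fun _ _ φ => ((singularChainsFunctor X).map φ).comm i j }
  shape i j h := by
    ext K : 2
    exact ((singularChainsFunctor X).obj K).shape i j h
  d_comp_d' i j k _ _ := by
    ext K : 2
    exact ((singularChainsFunctor X).obj K).d_comp_d i j k

/-- The Bredon cohomology group `H^i_G(X; M)`: the cohomology of the cochain complex with terms
`Hom(C_n(X), M)`, the homomorphisms being those of coefficient systems. -/
def bredonCohomology (M : CoeffSystem G) (i : ℕ) : ModuleCat.{0} ℤ :=
  ((bredonChains (G := G) X).linearYonedaObj ℤ M).homology i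

end Bredon

/-! ### The infinite join of a finite discrete set -/

/-- The infinite join `S * S * S * ⋯` of a finite discrete space `S`, in barycentric coordinates:
a point is a formal convex combination `∑ tᵢ sᵢ` with `sᵢ` in the `i`-th copy of `S`, almost all `tᵢ`
being zero, and `sᵢ` is disregarded where `tᵢ = 0`. It is recorded by the weights on the points
`(i, s)` of the disjoint union of the copies. -/
@[ext]
structure InfiniteJoin (S : Type) where
  /-- The weights. -/
  weight : ℕ × S →₀ ℝ
  nonneg : ∀ v, 0 ≤ weight v
  unique : ∀ i s t, weight (i, s) ≠ 0 → weight (i, t) ≠ 0 → s = t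
  sum_eq_one : (weight.sum fun _ r => r) = 1

namespace InfiniteJoin

variable (S : Type)

/-- The join of the first `N` copies of `S`. -/
def Stage (N : ℕ) : Type := {x : InfiniteJoin S // ∀ v, N ≤ v.1 → x.weight v = 0}

/-- For `S` finite and discrete, the join of `N` copies of `S` is a finite simplicial complex with
vertices the `(i, s)`, `i < N`; its topology is induced by the barycentric coordinates. -/
instance (N : ℕ) : TopologicalSpace (Stage S N) :=
  TopologicalSpace.induced (fun x (v : ℕ × S) => x.1.weight v) inferInstance

/-- The infinite join carries the colimit topology of the finite joins. -/
instance : TopologicalSpace (InfiniteJoin S) :=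
  ⨆ N : ℕ, TopologicalSpace.coinduced (fun x : Stage S N => x.1) inferInstance

variable {S} {G : Type} [Group G] [MulAction G S]

/-- `G` acts on the copies of `S` simultaneously: `g • ∑ tᵢ sᵢ = ∑ tᵢ (g • sᵢ)`. -/
instance : SMul G (InfiniteJoin S) where
  smul g x :=
    { weight := x.weight.equivMapDomain ((Equiv.refl ℕ).prodCongr (MulAction.toPerm g))
      nonneg := fun v => x.nonneg _
      unique := fun i s t hs ht =>
        MulAction.injective g⁻¹ (x.unique i (g⁻¹ • s) (g⁻¹ • t) hs ht)
      sum_eq_one := by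
        rw [Finsupp.equivMapDomain_eq_mapDomain, Finsupp.sum_mapDomain_index (by simp) (by simp)]
        exact x.sum_eq_one }

theorem weight_smul (g : G) (x : InfiniteJoin S) (i : ℕ) (s : S) :
    (g • x).weight (i, s) = x.weight (i, g⁻¹ • s) := rfl

instance : MulAction G (InfiniteJoin S) where
  one_smul x := by
    ext ⟨i, s⟩
    simp [weight_smul]
  mul_smul g h x := by
    ext ⟨i, s⟩
    simp [weight_smul, mul_smul]

instance : ContinuousConstSMul G (InfiniteJoin S) where
  continuous_const_smul g := by
    refine continuous_iSup_dom.mpr fun N => continuous_coinduced_dom.mpr ?_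
    let f : Stage S N → Stage S N := fun x => ⟨g • x.1, fun v hv => x.2 _ hv⟩
    have hf : Continuous f := by
      refine continuous_induced_rng.mpr (continuous_pi fun v => ?_)
      exact (continuous_apply ((v.1, g⁻¹ • v.2) : ℕ × S)).comp continuous_induced_dom
    have hi : Continuous (fun x : Stage S N => x.1) :=
      continuous_iSup_rng (i := N) continuous_coinduced_rng
    exact hi.comp hf

end InfiniteJoin

/-! ### Dihedral groups and the universal space -/

/-- The subgroup `H = ⟨y⟩` of order two of the dihedral group
`D_n = ⟨x, y | xⁿ = y² = 1, yx = x⁻¹y⟩`, with `x = r 1` and `y = sr 0`. -/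
def reflectionSubgroup (n : ℕ) : Subgroup (DihedralGroup n) :=
  Subgroup.zpowers (DihedralGroup.sr 0)

/-- The space `E_H D_n`, the infinite join of copies of `D_n/H`. -/
abbrev EHD (n : ℕ) : Type := InfiniteJoin (DihedralGroup n ⧸ reflectionSubgroup n)

/-- The restriction map `H^i(G; V) → H^i(K; V)` in group cohomology. -/
def groupCohomologyRes {G : Type} [Group G] (K : Subgroup G) (V : Rep.{0} ℤ G) (i : ℕ) :
    groupCohomology V i ⟶ groupCohomology (Rep.res K.subtype V) i :=
  groupCohomology.map K.subtype (𝟙 _) i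

/-- An abelian group is `m`-profinite if it is the limit of an inverse system, indexed by a directed
set, of abelian groups in which every element has order a product of primes dividing `m`
(that is, is killed by a power of `m`). -/
def IsMProfinite (m : ℕ) (B : Type) [AddCommGroup B] : Prop :=
  ∃ (I : Type) (_ : Preorder I) (_ : IsDirectedOrder I) (_ : Nonempty I)
    (F : Iᵒᵖ ⥤ AddCommGrpCat.{0}),
    (∀ (j : Iᵒᵖ) (x : F.obj j), ∃ k : ℕ, m ^ k • x = 0) ∧
      Nonempty (AddCommGrpCat.of B ≅ limit F)

end

/-!
Let `S` be the coefficient system which is `ℤ` on the orbits that map to `G/H` and zero on the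
others. All fixed point sets of the infinite join of `G/H` are contractible or empty, so its
singular chains are a projective resolution of `S`, and the Bredon cohomology of the join is
`Ext(S, M)`. When `H` is malnormal, a nontrivial isotropy group fixes at most one point of `G/H`,
and `S` has a second, algebraic resolution: `ℤ[Hom(-, G/H)]` in degree zero, followed by the bar
complex of `G` modulo the bar complex of `H`, which is concentrated at the orbit `G/e`. The
morphisms from the latter to `M` are the inhomogeneous cochains of `G` with values in `M(G/e)` which
vanish on `H`. They form the kernel of the restriction of cochains from `G` to `H`, which is
surjective, and the long exact sequence of this kernel is the one of the theorem: dropping the term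
of degree zero from the resolution does not change `Ext` in degrees at least two, and makes it
surject onto the original in degree one. Averaging over a finite group kills its cohomology when its
order acts invertibly on the coefficients, which is the case if they are `m`-profinite.
-/

open Opposite

noncomputable section

/-! ### Free presheaves of modules -/

section FreePresheaf

universe u v

variable {R : Type u} [Ring R] {O : Type v} [Category.{u} O] {ι : Type u} {L : ι → O}

/-- A basis of a presheaf of modules, consisting of elements `gen a` of its values at objects `L a`:
on every object, the restrictions of the elements `gen a` along all morphisms to the objects `L a`
form a basis. Such a presheaf is a direct sum of linearized representable presheaves. -/
structure PresheafBasis (P : Oᵒᵖ ⥤ ModuleCat.{u} R) (L : ι → O) where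
  gen : ∀ a, P.obj (op (L a))
  basis : ∀ K : O, Module.Basis (Σ a, K ⟶ L a) R (P.obj (op K))
  basis_apply : ∀ (K : O) (a : ι) (φ : K ⟶ L a), basis K ⟨a, φ⟩ = P.map φ.op (gen a)

namespace PresheafBasis

variable {P M : Oᵒᵖ ⥤ ModuleCat.{u} R} (B : PresheafBasis P L)

theorem map_basis {K K' : O} (ψ : K' ⟶ K) (a : ι) (φ : K ⟶ L a) :
    P.map ψ.op (B.basis K ⟨a, φ⟩) = B.basis K' ⟨a, ψ ≫ φ⟩ := by
  rw [B.basis_apply, B.basis_apply, op_comp, P.map_comp, ModuleCat.comp_apply]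

/-- The morphism out of a free presheaf which takes prescribed values on the generators. -/
def desc (m : ∀ a, M.obj (op (L a))) : P ⟶ M where
  app K := ModuleCat.ofHom ((B.basis K.unop).constr ℕ fun x => M.map x.2.op (m x.1))
  naturality K K' ψ := by
    ext : 1
    refine (B.basis K.unop).ext fun ⟨a, φ⟩ => ?_
    change (B.basis K'.unop).constr ℕ _ (P.map ψ.unop.op (B.basis K.unop ⟨a, φ⟩)) =
      M.map ψ ((B.basis K.unop).constr ℕ _ (B.basis K.unop ⟨a, φ⟩))
    rw [B.map_basis, Module.Basis.constr_basis, Module.Basis.constr_basis, op_comp, M.map_comp,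
      ModuleCat.comp_apply, Quiver.Hom.op_unop]

theorem desc_app_basis (m : ∀ a, M.obj (op (L a))) {K : O} (a : ι) (φ : K ⟶ L a) :
    (B.desc m).app (op K) (B.basis K ⟨a, φ⟩) = M.map φ.op (m a) :=
  (B.basis K).constr_basis ℕ _ _

theorem desc_app_gen (m : ∀ a, M.obj (op (L a))) (a : ι) :
    (B.desc m).app (op (L a)) (B.gen a) = m a := by
  simpa [B.basis_apply] using B.desc_app_basis m a (𝟙 _)

theorem hom_ext {f g : P ⟶ M} (h : ∀ a, f.app _ (B.gen a) = g.app _ (B.gen a)) : f = g := by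
  ext K : 3
  refine (B.basis K.unop).ext fun ⟨a, φ⟩ => ?_
  rw [B.basis_apply]
  refine (NatTrans.naturality_apply f φ.op (B.gen a)).trans ?_
  rw [h]
  exact (NatTrans.naturality_apply g φ.op (B.gen a)).symm

include B in
theorem projective : Projective P where
  factors {E X} f e he := by
    have lift_gen : ∀ a, ∃ x, e.app (op (L a)) x = f.app _ (B.gen a) := fun a =>
      (ModuleCat.epi_iff_surjective _).mp inferInstance _
    choose m hm using lift_gen
    refine ⟨B.desc m, B.hom_ext fun a => ?_⟩
    rw [← hm]
    exact congrArg _ (B.desc_app_gen m a)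

end PresheafBasis

variable (R) in
/-- The direct sum of the linearized representable presheaves `R[Hom(-, L a)]`. -/
def freePresheaf (L : ι → O) : Oᵒᵖ ⥤ ModuleCat.{u} R where
  obj K := (ModuleCat.free R).obj (Σ a, K.unop ⟶ L a)
  map ψ := (ModuleCat.free R).map (↾fun x => ⟨x.1, ψ.unop ≫ x.2⟩)

namespace freePresheaf

/-- The basis element of `freePresheaf R L` given by a morphism to one of the representing
objects. -/
def mk (L : ι → O) {K : O} (a : ι) (φ : K ⟶ L a) : (freePresheaf R L).obj (op K) :=
  ModuleCat.freeMk ⟨a, φ⟩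

theorem map_mk {K K' : O} (ψ : K' ⟶ K) (a : ι) (φ : K ⟶ L a) :
    (freePresheaf R L).map ψ.op (mk L a φ) = mk L a (ψ ≫ φ) :=
  ModuleCat.free_map_apply _ _

variable (R) in
/-- The tautological basis of a free presheaf. -/
def basis (L : ι → O) : PresheafBasis (freePresheaf R L) L where
  gen a := mk L a (𝟙 _)
  basis K := (Finsupp.basisSingleOne : Module.Basis (Σ a, K ⟶ L a) R _)
  basis_apply K a φ := by
    rw [map_mk, Category.comp_id]
    exact congrFun Finsupp.coe_basisSingleOne _

instance projective (L : ι → O) : Projective (freePresheaf R L) :=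
  (basis R L).projective

variable {M : Oᵒᵖ ⥤ ModuleCat.{u} R}

/-- The morphism out of a free presheaf with prescribed values on the generators. -/
abbrev desc (m : ∀ a, M.obj (op (L a))) : freePresheaf R L ⟶ M := (basis R L).desc m

theorem desc_mk (m : ∀ a, M.obj (op (L a))) {K : O} (a : ι) (φ : K ⟶ L a) :
    (desc m).app (op K) (mk L a φ) = M.map φ.op (m a) := by
  have h := (basis R L).desc_app_basis m a φ
  rwa [(basis R L).basis_apply, basis, map_mk, Category.comp_id] at h

theorem hom_ext {f g : freePresheaf R L ⟶ M}
    (h : ∀ a, f.app _ (mk L a (𝟙 _)) = g.app _ (mk L a (𝟙 _))) : f = g :=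
  (basis R L).hom_ext h

variable {A : Type*} [AddCommMonoid A] [Module R A] {K : O}

theorem linearMap_ext {f g : (freePresheaf R L).obj (op K) →ₗ[R] A}
    (h : ∀ a φ, f (mk L a φ) = g (mk L a φ)) : f = g :=
  Finsupp.lhom_ext' fun x => LinearMap.ext_ring (h x.1 x.2)

/-- The linear map out of a value of a free presheaf with prescribed values on the basis. -/
def lift (f : ∀ a, (K ⟶ L a) → A) : (freePresheaf R L).obj (op K) →ₗ[R] A :=
  Finsupp.linearCombination R fun x : Σ a, K ⟶ L a => f x.1 x.2

theorem lift_mk (f : ∀ a, (K ⟶ L a) → A) (a : ι) (φ : K ⟶ L a) :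
    lift f (mk (R := R) L a φ) = f a φ :=
  (Finsupp.linearCombination_single R _ _).trans (one_smul R _)

theorem subsingleton_obj (h : ∀ a, IsEmpty (K ⟶ L a)) :
    Subsingleton ((freePresheaf R L).obj (op K)) :=
  have : IsEmpty (Σ a, K ⟶ L a) := isEmpty_sigma.mpr h
  inferInstanceAs (Subsingleton ((Σ a, K ⟶ L a) →₀ R))

end freePresheaf

end FreePresheaf

/-! ### Projective resolutions of presheaves -/

section Resolution

universe u v w

variable {R : Type w} [Ring R] {O : Type v} [Category.{u} O]

theorem presheaf_exact_of_app {S : ShortComplex (Oᵒᵖ ⥤ ModuleCat.{w} R)}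
    (h : ∀ K, Function.Exact (S.f.app K) (S.g.app K)) : S.Exact := by
  rw [ShortComplex.exact_iff_isZero_homology]
  refine (Functor.isZero_iff _).mpr fun K => ?_
  refine IsZero.of_iso ?_ (S.mapHomologyIso ((evaluation _ _).obj K)).symm
  rw [← ShortComplex.exact_iff_isZero_homology,
    ShortComplex.ShortExact.moduleCat_exact_iff_function_exact]
  exact h K

/-- The projective resolution given by a chain complex of projective presheaves of modules with a
pointwise exact augmentation. -/
def projectiveResolutionOfExact (C : ChainComplex (Oᵒᵖ ⥤ ModuleCat.{w} R) ℕ)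
    (hC : ∀ n, Projective (C.X n)) {Z : Oᵒᵖ ⥤ ModuleCat.{w} R} (ε : C.X 0 ⟶ Z)
    (hε : ∀ K, Function.Surjective (ε.app K))
    (h₀ : ∀ K, Function.Exact ((C.d 1 0).app K) (ε.app K))
    (h : ∀ n K, Function.Exact ((C.d (n + 2) (n + 1)).app K) ((C.d (n + 1) n).app K)) :
    ProjectiveResolution Z :=
  have d_comp_ε : C.d 1 0 ≫ ε = 0 := by
    ext K x
    exact (h₀ K).apply_apply_eq_zero x
  { complex := C
    projective := hC
    π := (ChainComplex.toSingle₀Equiv C Z).symm ⟨ε, d_comp_ε⟩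
    quasiIso := ⟨fun i => by
      cases i with
      | zero =>
        rw [ChainComplex.quasiIsoAt₀_iff, ShortComplex.quasiIso_iff_of_zeros'
          _ (C.shape _ _ (by simp)) rfl rfl]
        constructor
        · refine presheaf_exact_of_app fun K => ?_
          have := h₀ K
          simpa using! this
        · have (K : Oᵒᵖ) : Epi (ε.app K) := (ModuleCat.epi_iff_surjective _).mpr (hε K)
          have : Epi ε := NatTrans.epi_of_epi_app _
          simpa using! this
      | succ i =>
        rw [quasiIsoAt_iff_exactAt' _ _ (ChainComplex.exactAt_succ_single_obj _ _),
          HomologicalComplex.exactAt_iff' _ (i + 2) (i + 1) i (by simp) (by simp)]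
        exact presheaf_exact_of_app (h i)⟩ }

end Resolution

/-! ### Morphisms of orbits -/

namespace OrbitCat

variable {G : Type} [Group G] {K L : OrbitCat G}

/-- The free orbit `G/e`. -/
abbrev free (G : Type) [Group G] : OrbitCat G := ⟨⊥⟩

/-- The image of the base point under a morphism of orbits, by which the morphism is determined. -/
def imageOne (φ : K ⟶ L) : G ⧸ L.sub :=
  MulActionHom.toFun φ ((1 : G) : G ⧸ K.sub)

theorem apply_mk (φ : K ⟶ L) (g : G) :
    MulActionHom.toFun φ (g : G ⧸ K.sub) = g • imageOne φ := by
  have h := MulActionHom.map_smul' φ g ((1 : G) : G ⧸ K.sub)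
  rwa [MulAction.Quotient.smul_coe, smul_eq_mul, mul_one] at h

theorem imageOne_injective : Function.Injective (imageOne : (K ⟶ L) → G ⧸ L.sub) := by
  intro φ ψ h
  refine MulActionHom.ext fun x => ?_
  induction x using Quotient.inductionOn' with
  | h g => exact (apply_mk φ g).trans ((congrArg (g • ·) h).trans (apply_mk ψ g).symm)

theorem smul_imageOne (φ : K ⟶ L) {k : G} (hk : k ∈ K.sub) : k • imageOne φ = imageOne φ := by
  have : (k : G ⧸ K.sub) = ((1 : G) : G ⧸ K.sub) := by
    rw [QuotientGroup.eq, mul_one]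
    exact inv_mem hk
  rw [← apply_mk, this]
  rfl

theorem imageOne_comp {P : OrbitCat G} (φ : K ⟶ L) (ψ : L ⟶ P) {g : G}
    (hg : imageOne φ = (g : G ⧸ L.sub)) : imageOne (φ ≫ ψ) = g • imageOne ψ := by
  rw [← apply_mk, ← hg]
  rfl

/-- The morphism of orbits which sends the base point to a given fixed point of the isotropy
group. -/
def homMk (q : G ⧸ L.sub) (h : ∀ k ∈ K.sub, k • q = q) : K ⟶ L :=
  show (G ⧸ K.sub) →[G] (G ⧸ L.sub) from
  { toFun := orbitMap (G ⧸ L.sub) (L := K.sub) ⟨q, fun k => h k k.2⟩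
    map_smul' := orbitMap_smul _ _ }

theorem imageOne_homMk (q : G ⧸ L.sub) (h : ∀ k ∈ K.sub, k • q = q) :
    imageOne (homMk (K := K) q h) = q :=
  one_smul G q

theorem eq_free_of_hom (φ : K ⟶ free G) : K = free G := by
  obtain ⟨K⟩ := K
  congr
  refine (Subgroup.eq_bot_iff_forall K).mpr fun k hk => ?_
  obtain ⟨g, hg⟩ := QuotientGroup.mk_surjective (imageOne φ)
  have h := smul_imageOne φ hk
  rw [← hg, MulAction.Quotient.smul_coe, eq_comm, QuotientGroup.eq, Subgroup.mem_bot,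
    inv_mul_eq_one, smul_eq_mul] at h
  exact mul_eq_right.mp h.symm

theorem imageOne_rightTranslation (g : G) :
    imageOne (rightTranslation g) = (g : G ⧸ (⊥ : Subgroup G)) :=
  congrArg (Quotient.mk'' : G → G ⧸ (⊥ : Subgroup G)) (one_mul g)

theorem rightTranslation_bijective :
    Function.Bijective (rightTranslation : G → (free G ⟶ free G)) := by
  refine ⟨fun g h e => ?_, fun φ => ?_⟩
  · have := congrArg imageOne e
    rw [imageOne_rightTranslation, imageOne_rightTranslation, QuotientGroup.eq,
      Subgroup.mem_bot] at this
    exact inv_mul_eq_one.mp this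
  · obtain ⟨g, hg⟩ := QuotientGroup.mk_surjective (imageOne φ)
    exact ⟨g, imageOne_injective ((imageOne_rightTranslation g).trans hg)⟩

/-- The projection `G/e → G/H`. -/
def proj (H : Subgroup G) : free G ⟶ (⟨H⟩ : OrbitCat G) :=
  homMk ((1 : G) : G ⧸ H) fun k hk => by rw [Subgroup.mem_bot.mp hk, one_smul]

theorem imageOne_rightTranslation_comp_proj (H : Subgroup G) (x : G) :
    imageOne (rightTranslation x ≫ proj H) = (x : G ⧸ H) := by
  rw [imageOne_comp _ _ (imageOne_rightTranslation x), proj, imageOne_homMk,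
    MulAction.Quotient.smul_coe, smul_eq_mul, mul_one]

theorem rightTranslation_comp_proj {H : Subgroup G} {h : G} (hh : h ∈ H) :
    rightTranslation h ≫ proj H = proj H := by
  refine imageOne_injective ?_
  rw [imageOne_rightTranslation_comp_proj, proj, imageOne_homMk, QuotientGroup.eq, mul_one]
  exact inv_mem hh

end OrbitCat

/-! ### The relative bar complex -/

section RelativeBar

variable {G : Type} [Group G]

/-- A family of sets of tuples which is closed under the face maps of the bar construction, the last
of which is `Fin.contractNth` at the last index: it drops the last entry. -/
structure FaceClosed (p : ∀ i, Set (Fin i → G)) : Prop where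
  tail : ∀ {i} {t : Fin (i + 1) → G}, t ∈ p (i + 1) → Fin.tail t ∈ p i
  contract : ∀ {i} {t : Fin (i + 1) → G}, t ∈ p (i + 1) →
    ∀ j : Fin (i + 1), Fin.contractNth j (· * ·) t ∈ p i

theorem faceClosed_empty : FaceClosed fun i => (∅ : Set (Fin i → G)) where
  tail h := h.elim
  contract h := h.elim

/-- The tuples of elements of a subgroup. -/
def tuplesIn (H : Subgroup G) (i : ℕ) : Set (Fin i → G) := {t | ∀ k, t k ∈ H}

theorem cons_mem_tuplesIn {H : Subgroup G} {i : ℕ} {a : G} {t : Fin i → G} (ha : a ∈ H)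
    (ht : t ∈ tuplesIn H i) : (Fin.cons a t : Fin (i + 1) → G) ∈ tuplesIn H (i + 1) :=
  fun k => Fin.cases ha ht k

theorem faceClosed_tuplesIn (H : Subgroup G) : FaceClosed (tuplesIn H) where
  tail h k := h k.succ
  contract h j k := by
    unfold Fin.contractNth
    split_ifs
    exacts [h _, H.mul_mem (h _) (h _), h _]

/-- The `i`-th term of the bar complex of `G` relative to a family of tuples, as a coefficient
system: it is free on the tuples outside the family, each placed at the free orbit. -/
abbrev relBar (p : ∀ i, Set (Fin i → G)) (i : ℕ) : CoeffSystem G :=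
  freePresheaf ℤ fun _ : {t : Fin i → G // t ∉ p i} => OrbitCat.free G

namespace relBar

variable (p : ∀ i, Set (Fin i → G)) {i : ℕ} {K K' : OrbitCat G} {M : CoeffSystem G}

open Classical in
/-- The class of a tuple in the relative bar complex, which is zero if the tuple belongs to the
family. -/
def mk (φ : K ⟶ OrbitCat.free G) (t : Fin i → G) : (relBar p i).obj (op K) :=
  if h : t ∈ p i then 0 else freePresheaf.mk _ ⟨t, h⟩ φ

variable {p}

theorem mk_of_mem (φ : K ⟶ OrbitCat.free G) {t : Fin i → G} (h : t ∈ p i) : mk p φ t = 0 :=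
  dif_pos h

theorem mk_of_notMem (φ : K ⟶ OrbitCat.free G) {t : Fin i → G} (h : t ∉ p i) :
    mk p φ t = freePresheaf.mk _ ⟨t, h⟩ φ :=
  dif_neg h

theorem map_mk (ψ : K' ⟶ K) (φ : K ⟶ OrbitCat.free G) (t : Fin i → G) :
    (relBar p i).map ψ.op (mk p φ t) = mk p (ψ ≫ φ) t := by
  by_cases h : t ∈ p i
  · rw [mk_of_mem _ h, mk_of_mem _ h, map_zero]
  · rw [mk_of_notMem _ h, mk_of_notMem _ h]
    exact freePresheaf.map_mk _ _ _

theorem hom_ext {f g : relBar p i ⟶ M}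
    (h : ∀ t, t ∉ p i → f.app _ (mk p (𝟙 _) t) = g.app _ (mk p (𝟙 _) t)) : f = g := by
  refine freePresheaf.hom_ext fun ⟨t, ht⟩ => ?_
  have := h t ht
  rwa [mk_of_notMem _ ht] at this

theorem linearMap_ext {A : Type*} [AddCommMonoid A] [Module ℤ A]
    {f g : (relBar p i).obj (op K) →ₗ[ℤ] A}
    (h : ∀ φ t, t ∉ p i → f (mk p φ t) = g (mk p φ t)) : f = g := by
  refine freePresheaf.linearMap_ext fun ⟨t, ht⟩ φ => ?_
  have := h φ t ht
  rwa [mk_of_notMem _ ht] at this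

/-- The morphism out of a term of the relative bar complex with prescribed values on the tuples
outside the family. -/
def desc (f : (Fin i → G) → M.obj (op (OrbitCat.free G))) : relBar p i ⟶ M :=
  freePresheaf.desc fun t => f t.1

theorem desc_mk (f : (Fin i → G) → M.obj (op (OrbitCat.free G))) (hf : ∀ t ∈ p i, f t = 0)
    (φ : K ⟶ OrbitCat.free G) (t : Fin i → G) :
    (desc f).app (op K) (mk p φ t) = M.map φ.op (f t) := by
  by_cases h : t ∈ p i
  · rw [mk_of_mem _ h, map_zero, hf t h, map_zero]
  · rw [mk_of_notMem _ h]
    exact freePresheaf.desc_mk (fun t : {t // t ∉ p i} => f t.1) ⟨t, h⟩ φ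

variable (p) in
/-- The boundary of a tuple in the relative bar complex. -/
def boundary (φ : K ⟶ OrbitCat.free G) (t : Fin (i + 1) → G) : (relBar p i).obj (op K) :=
  mk p (φ ≫ rightTranslation (t 0)) (Fin.tail t) +
    ∑ j : Fin (i + 1), (-1 : ℤ) ^ ((j : ℕ) + 1) • mk p φ (Fin.contractNth j (· * ·) t)

theorem boundary_of_mem (hp : FaceClosed p) (φ : K ⟶ OrbitCat.free G) {t : Fin (i + 1) → G}
    (h : t ∈ p (i + 1)) : boundary p φ t = 0 := by
  rw [boundary, mk_of_mem _ (hp.tail h), zero_add]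
  refine Finset.sum_eq_zero fun j _ => ?_
  rw [mk_of_mem _ (hp.contract h j), zsmul_zero]

variable (p) in
/-- The differential of the relative bar complex. -/
def d (i : ℕ) : relBar p (i + 1) ⟶ relBar p i :=
  desc fun t => boundary p (𝟙 _) t

theorem d_mk (hp : FaceClosed p) (φ : K ⟶ OrbitCat.free G) (t : Fin (i + 1) → G) :
    (d p i).app (op K) (mk p φ t) = boundary p φ t := by
  rw [d, desc_mk _ fun t h => boundary_of_mem hp _ h]
  simp only [boundary, map_add, map_sum, map_zsmul, map_mk, Category.comp_id, Category.id_comp]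

variable (p) in
/-- The cochain of values on tuples of a morphism out of a term of the relative bar complex. -/
def eval (i : ℕ) (M : CoeffSystem G) : (relBar p i ⟶ M) →+ ((Fin i → G) → M.atE) where
  toFun η t := η.app (op (OrbitCat.free G)) (mk p (𝟙 _) t)
  map_zero' := rfl
  map_add' _ _ := rfl

theorem eval_injective : Function.Injective (eval p i M) :=
  fun _ _ h => hom_ext fun t _ => congrFun h t

theorem eval_d_comp (hp : FaceClosed p) (η : relBar p i ⟶ M) :
    eval p (i + 1) M (d p i ≫ η) =
      (inhomogeneousCochains.d M.atE i).hom (eval p i M η) := by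
  funext t
  rw [inhomogeneousCochains.d_hom_apply]
  change η.app _ ((d p i).app _ (mk p (𝟙 _) t)) = _
  rw [d_mk hp, boundary, map_add, map_sum, Category.id_comp]
  congr 1
  · have h : (relBar p i).map (rightTranslation (t 0)).op (mk p (𝟙 _) (Fin.tail t)) =
        mk p (rightTranslation (t 0)) (Fin.tail t) := by
      rw [map_mk, Category.comp_id]
    rw [← h]
    exact NatTrans.naturality_apply η (rightTranslation (t 0)).op _
  · refine Finset.sum_congr rfl fun j _ => ?_
    rw [map_zsmul]
    exact (int_smul_eq_zsmul _ _ _).symm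

-- Evaluation on tuples embeds `Hom(relBar, relBar)` into inhomogeneous cochains, where `d² = 0`.
theorem d_comp_d (hp : FaceClosed p) (i : ℕ) : d p (i + 1) ≫ d p i = 0 := by
  refine eval_injective ?_
  have h := eval_d_comp hp (i := i) (𝟙 _)
  rw [Category.comp_id] at h
  rw [eval_d_comp hp, h, map_zero, ← ModuleCat.comp_apply,
    groupCohomology.inhomogeneousCochains.d_comp_d i (CoeffSystem.atE (relBar p i))]
  rfl

/-- The bar complex relative to a family of tuples. -/
def complex (hp : FaceClosed p) : ChainComplex (CoeffSystem G) ℕ :=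
  ChainComplex.of (relBar p) (d p) (d_comp_d hp)

theorem complex_d (hp : FaceClosed p) (i : ℕ) : (complex hp).d (i + 1) i = d p i :=
  ChainComplex.of_d _ _ _

end relBar

end RelativeBar

/-! ### The contraction of the bar complex -/

theorem contractNth_zero_cons {α : Type*} (op : α → α → α) {i : ℕ} (a : α)
    (t : Fin (i + 1) → α) :
    Fin.contractNth 0 op (Fin.cons a t : Fin (i + 2) → α) = Fin.cons (op a (t 0)) (Fin.tail t) := by
  funext k
  refine Fin.cases ?_ (fun k => ?_) k <;> simp [Fin.contractNth, Fin.tail]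

theorem contractNth_succ_cons {α : Type*} (op : α → α → α) {i : ℕ} (a : α)
    (t : Fin (i + 1) → α) (j : Fin (i + 1)) :
    Fin.contractNth j.succ op (Fin.cons a t : Fin (i + 2) → α) =
      Fin.cons a (Fin.contractNth j op t) := by
  funext k
  refine Fin.cases ?_ (fun k => ?_) k <;> simp [Fin.contractNth]

/-- The value of the unnormalized bar complex at the free orbit, with basis `x[t₁ | ⋯ | tᵢ]`. -/
abbrev bar (G : Type) [Group G] (i : ℕ) : Type :=
  (relBar (fun i => (∅ : Set (Fin i → G))) i).obj (op (OrbitCat.free G))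

namespace bar

open OrbitCat

variable {G : Type} [Group G] {i : ℕ}

/-- The basis element `x[t₁ | ⋯ | tᵢ]` of the bar complex. -/
abbrev mk (x : G) (t : Fin i → G) : bar G i :=
  relBar.mk (fun i => (∅ : Set (Fin i → G))) (rightTranslation x) t

/-- The differential of the bar complex. -/
def d (G : Type) [Group G] (i : ℕ) : bar G (i + 1) →ₗ[ℤ] bar G i :=
  ((relBar.d (fun i => (∅ : Set (Fin i → G))) i).app (op (free G))).hom

theorem d_mk (x : G) (t : Fin (i + 1) → G) :
    d G i (mk x t) = mk (x * t 0) (Fin.tail t) +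
      ∑ j : Fin (i + 1), (-1 : ℤ) ^ ((j : ℕ) + 1) • mk x (Fin.contractNth j (· * ·) t) := by
  refine (relBar.d_mk faceClosed_empty (rightTranslation x) t).trans ?_
  rw [relBar.boundary, ← rightTranslation_mul]

theorem d_d (b : bar G (i + 2)) : d G i (d G (i + 1) b) = 0 :=
  congrArg (fun f => f.app (op (free G)) b) (relBar.d_comp_d faceClosed_empty i)

section

variable {A : Type*} [AddCommMonoid A] [Module ℤ A]

theorem linearMap_ext {f g : bar G i →ₗ[ℤ] A} (h : ∀ x t, f (mk x t) = g (mk x t)) : f = g := by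
  refine relBar.linearMap_ext fun φ t _ => ?_
  obtain ⟨x, rfl⟩ := rightTranslation_bijective.surjective φ
  exact h x t

/-- The linear map out of the bar complex with prescribed values on the basis. -/
def lift (f : G → (Fin i → G) → A) : bar G i →ₗ[ℤ] A :=
  freePresheaf.lift fun t φ => f ((Equiv.ofBijective _ rightTranslation_bijective).symm φ) t.1

theorem lift_mk (f : G → (Fin i → G) → A) (x : G) (t : Fin i → G) : lift f (mk x t) = f x t := by
  rw [mk, relBar.mk_of_notMem _ (Set.notMem_empty t)]
  refine (freePresheaf.lift_mk _ _ _).trans ?_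
  rw [Equiv.ofBijective_symm_apply_apply]

end

/-- The operator `x[t₁ | ⋯ | tᵢ] ↦ σ(x)[σ(x)⁻¹x | t₁ | ⋯ | tᵢ]`, in homogeneous notation
`(g₀, …, gᵢ) ↦ (σ(g₀), g₀, …, gᵢ)`. -/
def contract (σ : G → G) (i : ℕ) : bar G i →ₗ[ℤ] bar G (i + 1) :=
  lift fun x t => mk (σ x) (Fin.cons ((σ x)⁻¹ * x) t)

theorem contract_mk (σ : G → G) (x : G) (t : Fin i → G) :
    contract σ i (mk x t) = mk (σ x) (Fin.cons ((σ x)⁻¹ * x) t) :=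
  lift_mk _ _ _

theorem d_contract_add_contract_d_mk (σ : G → G) (x : G) (t : Fin (i + 1) → G)
    (h : σ (x * t 0) = σ x) :
    d G (i + 1) (contract σ (i + 1) (mk x t)) + contract σ i (d G i (mk x t)) = mk x t := by
  rw [contract_mk, d_mk, d_mk, map_add, map_sum, contract_mk, h, Fin.sum_univ_succ,
    contractNth_zero_cons]
  simp only [contractNth_succ_cons, map_zsmul, contract_mk, Fin.cons_zero, Fin.tail_cons,
    Fin.val_zero, Fin.val_succ, mul_inv_cancel_left, zero_add, pow_one, neg_zsmul, one_zsmul,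
    pow_succ (-1 : ℤ) (_ + 1), mul_neg, mul_one, Finset.sum_neg_distrib, mul_assoc]
  abel

theorem d_contract_mk_zero (σ : G → G) (x : G) (t : Fin 0 → G) :
    d G 0 (contract σ 0 (mk x t)) = mk x t - mk (σ x) t := by
  rw [contract_mk, d_mk]
  simp only [Fin.cons_zero, mul_inv_cancel_left, Fin.tail_cons, Fin.sum_univ_succ, Fin.val_zero,
    zero_add, pow_one, neg_zsmul, one_zsmul, Finset.univ_eq_empty, Finset.sum_empty, add_zero,
    sub_eq_add_neg]
  congr 3
  exact Subsingleton.elim _ _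

theorem d_contract_one_add_contract_one_d (b : bar G (i + 1)) :
    d G (i + 1) (contract 1 (i + 1) b) + contract 1 i (d G i b) = b := by
  have : d G (i + 1) ∘ₗ contract 1 (i + 1) + contract 1 i ∘ₗ d G i = LinearMap.id :=
    linearMap_ext fun x t => d_contract_add_contract_d_mk _ x t rfl
  exact LinearMap.congr_fun this b

end bar

/-! ### The coefficient system supported on the orbits over `G/H` -/

section OrbitSupport

variable {G : Type} [Group G] (H : Subgroup G)

/-- The coefficient system `ℤ[Hom(-, G/H)]`. -/
abbrev linOrbit : CoeffSystem G := freePresheaf ℤ fun _ : Unit => (⟨H⟩ : OrbitCat G)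

variable {H} in
/-- The basis element of a value of `linOrbit` given by a morphism to `G/H`. -/
abbrev linOrbit.mk {K : OrbitCat G} (φ : K ⟶ (⟨H⟩ : OrbitCat G)) : (linOrbit H).obj (op K) :=
  freePresheaf.mk (fun _ : Unit => (⟨H⟩ : OrbitCat G)) () φ

/-- The coefficient system with value `ℤ` at the orbits which map to `G/H`, and zero elsewhere. -/
def orbitSupport : CoeffSystem G where
  obj K := (ModuleCat.free ℤ).obj (PLift (Nonempty (K.unop ⟶ (⟨H⟩ : OrbitCat G))))
  map ψ := (ModuleCat.free ℤ).map (↾fun h => ⟨h.down.map fun φ => ψ.unop ≫ φ⟩)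

namespace orbitSupport

variable {H}

/-- The generator of a nonzero value of `orbitSupport`. -/
def one {K : OrbitCat G} (h : Nonempty (K ⟶ (⟨H⟩ : OrbitCat G))) :
    (orbitSupport H).obj (op K) :=
  ModuleCat.freeMk ⟨h⟩

theorem map_one {K K' : OrbitCat G} (ψ : K' ⟶ K) (h : Nonempty (K ⟶ (⟨H⟩ : OrbitCat G)))
    (h' : Nonempty (K' ⟶ (⟨H⟩ : OrbitCat G))) : (orbitSupport H).map ψ.op (one h) = one h' :=
  Finsupp.mapDomain_single

end orbitSupport

namespace linOrbit

/-- The augmentation of `ℤ[Hom(-, G/H)]`. -/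
def aug : linOrbit H ⟶ orbitSupport H :=
  freePresheaf.desc fun _ => orbitSupport.one ⟨𝟙 _⟩

variable {H}

theorem aug_mk {K : OrbitCat G} (φ : K ⟶ (⟨H⟩ : OrbitCat G)) :
    (aug H).app (op K) (mk φ) = orbitSupport.one ⟨φ⟩ := by
  have h := freePresheaf.desc_mk (L := fun _ : Unit => (⟨H⟩ : OrbitCat G)) (M := orbitSupport H)
    (fun _ => orbitSupport.one ⟨𝟙 _⟩) () φ
  exact h.trans (orbitSupport.map_one φ _ _)

theorem aug_app_apply {K : OrbitCat G} (z : (linOrbit H).obj (op K)) :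
    (aug H).app (op K) z = Finsupp.mapDomain
      (fun x : Σ _ : Unit, K ⟶ (⟨H⟩ : OrbitCat G) => PLift.up (Nonempty.intro x.2)) z := by
  let f (x : Σ _ : Unit, K ⟶ (⟨H⟩ : OrbitCat G)) := PLift.up (Nonempty.intro x.2)
  have h : ((aug H).app (op K)).hom = Finsupp.lmapDomain ℤ ℤ f :=
    freePresheaf.linearMap_ext fun _ φ => (aug_mk φ).trans
      (Finsupp.mapDomain_single (f := f) (a := ⟨(), φ⟩) (b := (1 : ℤ))).symm
  exact LinearMap.congr_fun h z

theorem aug_surjective (K : (OrbitCat G)ᵒᵖ) : Function.Surjective ((aug H).app K) := by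
  intro y
  obtain ⟨z, hz⟩ := Finsupp.mapDomain_surjective (M := ℤ)
    (f := fun x : Σ _ : Unit, K.unop ⟶ (⟨H⟩ : OrbitCat G) => PLift.up (Nonempty.intro x.2))
    (fun ⟨⟨φ⟩⟩ => ⟨⟨(), φ⟩, rfl⟩) y
  exact ⟨z, (aug_app_apply z).trans hz⟩

theorem aug_injective {K : OrbitCat G} [Subsingleton (K ⟶ (⟨H⟩ : OrbitCat G))] :
    Function.Injective ((aug H).app (op K)) := by
  intro y z hyz
  rw [aug_app_apply, aug_app_apply] at hyz
  refine Finsupp.mapDomain_injective (fun ⟨_, φ⟩ ⟨_, ψ⟩ _ => ?_) hyz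
  rw [Subsingleton.elim φ ψ]

end linOrbit

end OrbitSupport

/-! ### The relative resolution -/

section RelativeResolution

open OrbitCat

variable {G : Type} [Group G] {i : ℕ}

namespace relBar

variable (H : Subgroup G)

/-- The differential of the relative resolution from degree one to degree zero. -/
def aug : relBar (tuplesIn H) 1 ⟶ linOrbit H :=
  desc fun t => linOrbit.mk (rightTranslation (t 0) ≫ proj H) - linOrbit.mk (proj H)

theorem aug_mk {K : OrbitCat G} (φ : K ⟶ free G) (t : Fin 1 → G) :
    (aug H).app (op K) (mk _ φ t) =
      linOrbit.mk (φ ≫ rightTranslation (t 0) ≫ proj H) - linOrbit.mk (φ ≫ proj H) := by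
  rw [aug, desc_mk, map_sub, freePresheaf.map_mk, freePresheaf.map_mk]
  intro t ht
  rw [rightTranslation_comp_proj (ht 0), sub_self]

theorem d_comp_aug : d (tuplesIn H) 1 ≫ aug H = 0 := by
  refine hom_ext fun t _ => ?_
  change (aug H).app _ ((d (tuplesIn H) 1).app _ (mk _ (𝟙 _) t)) = 0
  rw [d_mk (faceClosed_tuplesIn H), boundary, map_add, map_sum]
  simp only [map_zsmul, aug_mk, Fin.sum_univ_succ, Category.id_comp]
  simp [Fin.contractNth, rightTranslation_mul, Fin.tail]

theorem aug_comp_aug : aug H ≫ linOrbit.aug H = 0 := by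
  refine hom_ext fun t _ => ?_
  change (linOrbit.aug H).app _ ((aug H).app _ (mk _ (𝟙 _) t)) = 0
  rw [aug_mk, map_sub, linOrbit.aug_mk, linOrbit.aug_mk, sub_self]

/-- The projection of the bar complex onto the relative bar complex. -/
def ofBar (i : ℕ) : bar G i →ₗ[ℤ] (relBar (tuplesIn H) i).obj (op (free G)) :=
  bar.lift fun x t => mk _ (rightTranslation x) t

theorem ofBar_mk (x : G) (t : Fin i → G) :
    ofBar H i (bar.mk x t) = mk _ (rightTranslation x) t :=
  bar.lift_mk _ _ _

theorem ofBar_d (b : bar G (i + 1)) :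
    ofBar H i (bar.d G i b) = (d (tuplesIn H) i).app _ (ofBar H (i + 1) b) := by
  have : ofBar H i ∘ₗ bar.d G i = ((d (tuplesIn H) i).app _).hom ∘ₗ ofBar H (i + 1) := by
    refine bar.linearMap_ext fun x t => ?_
    refine Eq.trans ?_ ((congrArg _ (ofBar_mk H x t)).trans
      (d_mk (faceClosed_tuplesIn H) _ _)).symm
    refine (congrArg (ofBar H i) (bar.d_mk x t)).trans ?_
    simp only [map_add, map_sum, map_zsmul, ofBar_mk, boundary, rightTranslation_mul]
  exact LinearMap.congr_fun this b

/-- The section of `ofBar` which preserves the bases. -/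
def toBar (i : ℕ) : (relBar (tuplesIn H) i).obj (op (free G)) →ₗ[ℤ] bar G i :=
  freePresheaf.lift fun t φ => mk _ φ t.1

theorem toBar_mk (x : G) {t : Fin i → G} (ht : t ∉ tuplesIn H i) :
    toBar H i (mk _ (rightTranslation x) t) = bar.mk x t := by
  rw [mk_of_notMem _ ht]
  exact freePresheaf.lift_mk _ _ _

theorem ofBar_toBar (z : (relBar (tuplesIn H) i).obj (op (free G))) :
    ofBar H i (toBar H i z) = z := by
  have : ofBar H i ∘ₗ toBar H i = LinearMap.id := by
    refine linearMap_ext fun φ t ht => ?_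
    obtain ⟨x, rfl⟩ := rightTranslation_bijective.surjective φ
    exact (congrArg _ (toBar_mk H x ht)).trans (ofBar_mk H x t)
  exact LinearMap.congr_fun this z

theorem eq_zero_of_ofBar_eq_zero {A : Type*} [AddCommGroup A] [Module ℤ A]
    (T : bar G i →ₗ[ℤ] A) (hT : ∀ x, ∀ t ∈ tuplesIn H i, T (bar.mk x t) = 0) {b : bar G i}
    (hb : ofBar H i b = 0) : T b = 0 := by
  have : T = T ∘ₗ toBar H i ∘ₗ ofBar H i := by
    refine bar.linearMap_ext fun x t => ?_
    rw [LinearMap.comp_apply, LinearMap.comp_apply, ofBar_mk]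
    by_cases ht : t ∈ tuplesIn H i
    · rw [mk_of_mem _ ht, map_zero, map_zero, hT x t ht]
    · rw [toBar_mk H x ht]
  rw [this, LinearMap.comp_apply, LinearMap.comp_apply, hb, map_zero, map_zero]

/-- A choice of representatives of the cosets, as a map from the group to itself. -/
def cosetRep (x : G) : G := Quotient.out (x : G ⧸ H)

theorem cosetRep_mul (x : G) {h : G} (hh : h ∈ H) : cosetRep H (x * h) = cosetRep H x := by
  rw [cosetRep, QuotientGroup.mk_mul_of_mem x hh, cosetRep]

theorem cosetRep_inv_mul_mem (x : G) : (cosetRep H x)⁻¹ * x ∈ H := by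
  rw [← QuotientGroup.eq]
  exact QuotientGroup.out_eq' _

theorem ofBar_contract_cosetRep_eq_zero {b : bar G i} (hb : ofBar H i b = 0) :
    ofBar H (i + 1) (bar.contract (cosetRep H) i b) = 0 := by
  refine eq_zero_of_ofBar_eq_zero H (ofBar H (i + 1) ∘ₗ bar.contract (cosetRep H) i)
    (fun x t ht => ?_) hb
  rw [LinearMap.comp_apply, bar.contract_mk, ofBar_mk, mk_of_mem]
  exact cons_mem_tuplesIn (cosetRep_inv_mul_mem H x) ht

theorem ofBar_zero_eq_zero (b : bar G 0) : ofBar H 0 b = 0 := by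
  have : ofBar H 0 = 0 := bar.linearMap_ext fun x t => by
    rw [ofBar_mk, mk_of_mem _ fun k => k.elim0, LinearMap.zero_apply]
  rw [this, LinearMap.zero_apply]

theorem d_contract_cosetRep_add {b : bar G (i + 1)} (hb : ofBar H (i + 1) b = 0) :
    bar.d G (i + 1) (bar.contract (cosetRep H) (i + 1) b) +
      bar.contract (cosetRep H) i (bar.d G i b) = b := by
  refine sub_eq_zero.mp (eq_zero_of_ofBar_eq_zero H (bar.d G (i + 1) ∘ₗ
    bar.contract (cosetRep H) (i + 1) + bar.contract (cosetRep H) i ∘ₗ bar.d G i - LinearMap.id)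
    (fun x t ht => ?_) hb)
  exact sub_eq_zero.mpr
    (bar.d_contract_add_contract_d_mk _ x t (cosetRep_mul H x (ht 0)))

-- `b - v` is a cycle of the contractible complex `bar`.
theorem exists_d_eq_ofBar {b v : bar G (i + 1)} (hv : ofBar H (i + 1) v = 0)
    (hbv : bar.d G i b = bar.d G i v) :
    ∃ y, (d (tuplesIn H) (i + 1)).app _ y = ofBar H (i + 1) b := by
  refine ⟨ofBar H (i + 2) (bar.contract 1 (i + 1) (b - v)), ?_⟩
  have h := bar.d_contract_one_add_contract_one_d (b - v)
  rw [map_sub (bar.d G i), hbv, sub_self, map_zero, add_zero] at h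
  rw [← ofBar_d, h, map_sub, hv, sub_zero]

theorem d_exact_free (i : ℕ) :
    Function.Exact ((d (tuplesIn H) (i + 2)).app (op (free G)))
      ((d (tuplesIn H) (i + 1)).app (op (free G))) := by
  intro z
  constructor
  · intro hz
    obtain ⟨b, rfl⟩ : ∃ b, ofBar H (i + 2) b = z := ⟨_, ofBar_toBar H z⟩
    have hdb : ofBar H (i + 1) (bar.d G (i + 1) b) = 0 := by rw [ofBar_d, hz]
    have h := d_contract_cosetRep_add H hdb
    rw [bar.d_d, map_zero, add_zero] at h
    exact exists_d_eq_ofBar H (ofBar_contract_cosetRep_eq_zero H hdb) h.symm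
  · rintro ⟨y, rfl⟩
    exact congrArg (fun f => f.app (op (free G)) y) (d_comp_d (faceClosed_tuplesIn H) (i + 1))

end relBar

namespace linOrbit

open relBar

variable (H : Subgroup G)

/-- The projection of the bar complex in degree zero onto `ℤ[G/H]`. -/
def ofBar : bar G 0 →ₗ[ℤ] (linOrbit H).obj (op (free G)) :=
  bar.lift fun x _ => linOrbit.mk (rightTranslation x ≫ proj H)

theorem ofBar_mk (x : G) (t : Fin 0 → G) :
    ofBar H (bar.mk x t) = linOrbit.mk (rightTranslation x ≫ proj H) :=
  bar.lift_mk _ _ _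

theorem ofBar_d (b : bar G 1) :
    ofBar H (bar.d G 0 b) = (relBar.aug H).app _ (relBar.ofBar H 1 b) := by
  have : ofBar H ∘ₗ bar.d G 0 = ((relBar.aug H).app _).hom ∘ₗ relBar.ofBar H 1 := by
    refine bar.linearMap_ext fun x t => ?_
    refine Eq.trans ?_ ((congrArg _ (relBar.ofBar_mk H x t)).trans (relBar.aug_mk H _ _)).symm
    refine (congrArg (ofBar H) (bar.d_mk x t)).trans ?_
    simp only [map_add, map_sum, map_zsmul, ofBar_mk, Fin.sum_univ_succ]
    simp [rightTranslation_mul, sub_eq_add_neg]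
  exact LinearMap.congr_fun this b

/-- The section of `ofBar` given by representatives of the cosets. -/
def toBar : (linOrbit H).obj (op (free G)) →ₗ[ℤ] bar G 0 :=
  freePresheaf.lift fun _ φ => bar.mk (Quotient.out (imageOne φ)) Fin.elim0

theorem toBar_mk (φ : free G ⟶ (⟨H⟩ : OrbitCat G)) :
    toBar H (linOrbit.mk φ) = bar.mk (Quotient.out (imageOne φ)) Fin.elim0 :=
  freePresheaf.lift_mk _ _ _

theorem ofBar_toBar (z : (linOrbit H).obj (op (free G))) : ofBar H (toBar H z) = z := by
  have hs : ofBar H ∘ₗ toBar H = LinearMap.id := by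
    refine freePresheaf.linearMap_ext fun _ φ => ?_
    refine (congrArg (ofBar H) (toBar_mk H φ)).trans ((ofBar_mk H _ _).trans ?_)
    refine congrArg linOrbit.mk (imageOne_injective ?_)
    rw [imageOne_rightTranslation_comp_proj]
    exact QuotientGroup.out_eq' _
  exact LinearMap.congr_fun hs z

theorem d_contract_cosetRep {b : bar G 0} (hb : ofBar H b = 0) :
    bar.d G 0 (bar.contract (cosetRep H) 0 b) = b := by
  have : bar.d G 0 ∘ₗ bar.contract (cosetRep H) 0 = LinearMap.id - toBar H ∘ₗ ofBar H := by
    refine bar.linearMap_ext fun x t => (bar.d_contract_mk_zero _ _ _).trans ?_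
    rw [LinearMap.sub_apply, LinearMap.id_apply, LinearMap.comp_apply, ofBar_mk, toBar_mk,
      imageOne_rightTranslation_comp_proj, cosetRep, Subsingleton.elim t Fin.elim0]
  refine (LinearMap.congr_fun this b).trans ?_
  rw [LinearMap.sub_apply, LinearMap.id_apply, LinearMap.comp_apply, hb, map_zero, sub_zero]

theorem d_contract_one {b : bar G 0} (hb : (aug H).app _ (ofBar H b) = 0) :
    bar.d G 0 (bar.contract 1 0 b) = b := by
  let c : (orbitSupport H).obj (op (free G)) →ₗ[ℤ] bar G 0 :=
    Finsupp.linearCombination ℤ fun _ => bar.mk 1 Fin.elim0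
  have c_one (h) : c (orbitSupport.one h) = bar.mk 1 Fin.elim0 :=
    (Finsupp.linearCombination_single ℤ _ _).trans (one_smul ℤ _)
  have : bar.d G 0 ∘ₗ bar.contract 1 0 =
      LinearMap.id - c ∘ₗ ((aug H).app _).hom ∘ₗ ofBar H := by
    refine bar.linearMap_ext fun x t => (bar.d_contract_mk_zero _ _ _).trans ?_
    change _ = bar.mk x t - c ((aug H).app _ (ofBar H (bar.mk x t)))
    rw [ofBar_mk, aug_mk, c_one, Pi.one_apply, Subsingleton.elim t Fin.elim0]
  refine (LinearMap.congr_fun this b).trans ?_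
  change b - c ((aug H).app _ (ofBar H b)) = b
  rw [hb, map_zero, sub_zero]

theorem d_exact_aug_free :
    Function.Exact ((relBar.d (tuplesIn H) 1).app (op (free G)))
      ((relBar.aug H).app (op (free G))) := by
  intro z
  constructor
  · intro hz
    obtain ⟨b, rfl⟩ : ∃ b, relBar.ofBar H 1 b = z := ⟨_, relBar.ofBar_toBar H z⟩
    have hdb : ofBar H (bar.d G 0 b) = 0 := by rw [ofBar_d, hz]
    exact exists_d_eq_ofBar H (ofBar_contract_cosetRep_eq_zero H (ofBar_zero_eq_zero H _))
      (d_contract_cosetRep H hdb).symm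
  · rintro ⟨y, rfl⟩
    exact congrArg (fun f => f.app (op (free G)) y) (relBar.d_comp_aug H)

theorem aug_exact_aug_free :
    Function.Exact ((relBar.aug H).app (op (free G))) ((aug H).app (op (free G))) := by
  intro z
  constructor
  · intro hz
    obtain ⟨b, rfl⟩ : ∃ b, ofBar H b = z := ⟨_, ofBar_toBar H z⟩
    exact ⟨relBar.ofBar H 1 (bar.contract 1 0 b), by rw [← ofBar_d, d_contract_one H hz]⟩
  · rintro ⟨y, rfl⟩
    exact congrArg (fun f => f.app (op (free G)) y) (relBar.aug_comp_aug H)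

theorem aug_exact_aug {K : OrbitCat G} (hK : Subsingleton (K ⟶ (⟨H⟩ : OrbitCat G))) :
    Function.Exact ((relBar.aug H).app (op K)) ((aug H).app (op K)) := by
  intro z
  constructor
  · intro hz
    exact ⟨0, (map_zero _).trans (aug_injective (hz.trans (map_zero _).symm)).symm⟩
  · rintro ⟨y, rfl⟩
    exact congrArg (fun f => f.app (op K) y) (relBar.aug_comp_aug H)

end linOrbit

variable (H : Subgroup G)

/-- The relative bar complex, with `ℤ[Hom(-, G/H)]` in place of its zero term in degree zero. -/
def relComplex : ChainComplex (CoeffSystem G) ℕ :=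
  ChainComplex.augment (ChainComplex.truncate.obj (relBar.complex (faceClosed_tuplesIn H)))
    (relBar.aug H) <| by
      change (relBar.complex (faceClosed_tuplesIn H)).d 2 1 ≫ relBar.aug H = 0
      rw [relBar.complex_d]
      exact relBar.d_comp_aug H

theorem relComplex_d_one_zero : (relComplex H).d 1 0 = relBar.aug H := rfl

theorem relComplex_d_succ (i : ℕ) :
    (relComplex H).d (i + 2) (i + 1) = relBar.d (tuplesIn H) (i + 1) :=
  relBar.complex_d (faceClosed_tuplesIn H) (i + 1)

theorem relComplex_projective (i : ℕ) : Projective ((relComplex H).X i) := by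
  cases i with
  | zero => exact freePresheaf.projective _
  | succ i => exact freePresheaf.projective fun _ : {t // t ∉ tuplesIn H (i + 1)} => free G

theorem relComplex_exact (i : ℕ) (K : (OrbitCat G)ᵒᵖ) :
    Function.Exact (((relComplex H).d (i + 2) (i + 1)).app K)
      (((relComplex H).d (i + 1) i).app K) := by
  obtain ⟨K⟩ := K
  rcases isEmpty_or_nonempty (K ⟶ free G) with hK | ⟨⟨φ⟩⟩
  · have : Subsingleton (((relComplex H).X (i + 1)).obj (op K)) :=
      freePresheaf.subsingleton_obj fun _ => hK
    exact fun z => ⟨fun _ => ⟨0, Subsingleton.elim _ _⟩, fun _ => by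
      rw [Subsingleton.elim z 0, map_zero]⟩
  · obtain rfl := eq_free_of_hom φ
    rw [relComplex_d_succ]
    cases i with
    | zero => exact linOrbit.d_exact_aug_free H
    | succ i =>
      rw [relComplex_d_succ]
      exact relBar.d_exact_free H i

variable {H} in
/-- If an orbit with nontrivial isotropy has at most one map to `G/H`, then the relative bar
complex is a projective resolution. -/
def relResolution (hH : ∀ K : OrbitCat G, IsEmpty (K ⟶ free G) →
    Subsingleton (K ⟶ (⟨H⟩ : OrbitCat G))) : ProjectiveResolution (orbitSupport H) :=
  projectiveResolutionOfExact (relComplex H) (relComplex_projective H) (linOrbit.aug H)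
    linOrbit.aug_surjective
    (fun ⟨K⟩ => by
      rw [relComplex_d_one_zero]
      rcases isEmpty_or_nonempty (K ⟶ free G) with hK | ⟨⟨φ⟩⟩
      · exact linOrbit.aug_exact_aug H (hH K hK)
      · obtain rfl := eq_free_of_hom φ
        exact linOrbit.aug_exact_aug_free H)
    (relComplex_exact H)

end RelativeResolution

/-! ### Relative cohomology -/

/-- An additive map, as a morphism of `ℤ`-modules; the `ℤ`-module structure of an object of
`ModuleCat ℤ` need not be definitionally the one coming from its addition. -/
def homOfAddMonoidHom {A B : ModuleCat.{0} ℤ} (f : A →+ B) : A ⟶ B :=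
  ModuleCat.ofHom
    { toFun := f
      map_add' := map_add f
      map_smul' := fun n x => map_intCast_smul f ℤ ℤ n x }

section LinearYoneda

variable {C : Type*} [Category.{0} C] [Abelian C] [Linear ℤ C]

/-- The map of cochain complexes `Hom(E, M) → Hom(D, M)` induced by a chain map `D → E`. -/
def linearYonedaMap {D E : ChainComplex C ℕ} (f : D ⟶ E) (M : C) :
    E.linearYonedaObj ℤ M ⟶ D.linearYonedaObj ℤ M where
  f i := ((linearYoneda ℤ C).obj M).map (f.f i).op
  comm' i j _ := by
    refine ConcreteCategory.hom_ext _ _ fun (η : E.X i ⟶ M) => ?_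
    exact (f.comm_assoc j i η).symm

/-- Homotopy equivalent chain complexes have isomorphic cohomology with coefficients in `M`. -/
def linearYonedaHomologyIso {D E : ChainComplex C ℕ} (e : HomotopyEquiv D E) (M : C) (i : ℕ) :
    (D.linearYonedaObj ℤ M).homology i ≅ (E.linearYonedaObj ℤ M).homology i :=
  HomologicalComplex.homologyUnop _ _ ≪≫
    ((((linearYoneda ℤ C).obj M).rightOp.mapHomotopyEquiv e).toHomologyIso i).symm.unop ≪≫
    (HomologicalComplex.homologyUnop _ _).symm

end LinearYoneda

section HomologyMap

variable {C : Type*} [Category C] [Abelian C] {K L : CochainComplex C ℕ} (f : K ⟶ L)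

theorem isIso_homologyMap_add_two (hf : ∀ i, IsIso (f.f (i + 1))) (i : ℕ) :
    IsIso (HomologicalComplex.homologyMap f (i + 2)) := by
  rw [← quasiIsoAt_iff_isIso_homologyMap,
    quasiIsoAt_iff' f (i + 1) (i + 2) (i + 3) (by simp) (by simp)]
  let φ := (HomologicalComplex.shortComplexFunctor' C _ (i + 1) (i + 2) (i + 3)).map f
  have : IsIso φ.τ₁ := hf i
  have : IsIso φ.τ₂ := hf (i + 1)
  have : IsIso φ.τ₃ := hf (i + 2)
  exact ShortComplex.quasiIso_of_epi_of_isIso_of_mono φ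

theorem epi_homologyMap_one (h₁ : IsIso (f.f 1)) (h₂ : IsIso (f.f 2)) :
    Epi (HomologicalComplex.homologyMap f 1) := by
  have hnext : (ComplexShape.up ℕ).next 1 = 2 := by simp
  have : Mono (f.f ((ComplexShape.up ℕ).next 1)) := by rw [hnext]; infer_instance
  have hcycles : IsIso (HomologicalComplex.cyclesMap f 1) :=
    ShortComplex.isIso_cyclesMap_of_isIso_of_mono' _ h₁ this
  exact ShortComplex.epi_homologyMap_of_epi_cyclesMap' _ (@IsIso.epi_of_iso _ _ _ _ _ hcycles)

end HomologyMap

section RelativeCohomology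

variable {G : Type} [Group G] (H : Subgroup G) (M : CoeffSystem G)

/-- The relative cochain complex of the pair `(G, H)`: it is isomorphic to the complex of those
inhomogeneous cochains of `G` which vanish on `H`. -/
abbrev relCochains : CochainComplex (ModuleCat.{0} ℤ) ℕ :=
  (relBar.complex (faceClosed_tuplesIn H)).linearYonedaObj ℤ M

/-- The inclusion of the relative cochains into the inhomogeneous cochains. -/
def relCochainsIncl : relCochains H M ⟶ groupCohomology.inhomogeneousCochains M.atE where
  f i := homOfAddMonoidHom (relBar.eval (tuplesIn H) i M)
  comm' i j hij := by
    obtain rfl : i + 1 = j := hij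
    rw [groupCohomology.inhomogeneousCochains.d_def]
    refine ConcreteCategory.hom_ext _ _ fun (η : relBar (tuplesIn H) i ⟶ M) => ?_
    refine (relBar.eval_d_comp (faceClosed_tuplesIn H) η).symm.trans ?_
    rw [← relBar.complex_d (faceClosed_tuplesIn H)]
    rfl

/-- The restriction of inhomogeneous cochains to a subgroup. -/
abbrev cochainsRes :
    groupCohomology.inhomogeneousCochains M.atE ⟶
      groupCohomology.inhomogeneousCochains (Rep.res H.subtype M.atE) :=
  groupCohomology.cochainsMap H.subtype (𝟙 _)

theorem relCochainsIncl_comp_cochainsRes : relCochainsIncl H M ≫ cochainsRes H M = 0 := by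
  refine HomologicalComplex.hom_ext _ _ fun i => ?_
  refine ConcreteCategory.hom_ext _ _ fun (η : relBar (tuplesIn H) i ⟶ M) => ?_
  refine funext fun t : Fin i → H => ?_
  change η.app _ (relBar.mk (tuplesIn H) (𝟙 _) fun k => (t k : G)) = 0
  rw [relBar.mk_of_mem (p := tuplesIn H) _ fun k => (t k).2, map_zero]

theorem exists_eval_eq {i : ℕ} {f : (Fin i → G) → M.atE} (hf : ∀ t ∈ tuplesIn H i, f t = 0) :
    ∃ η, relBar.eval (tuplesIn H) i M η = f := by
  refine ⟨relBar.desc f, funext fun t => (relBar.desc_mk f hf (𝟙 _) t).trans ?_⟩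
  rw [op_id, M.map_id]
  rfl

theorem relCochains_shortExact :
    (ShortComplex.mk _ _ (relCochainsIncl_comp_cochainsRes H M)).ShortExact := by
  refine HomologicalComplex.shortExact_of_degreewise_shortExact _ fun i => ?_
  refine { exact := ?_, mono_f := ?_, epi_g := ?_ }
  · refine (ShortComplex.ShortExact.moduleCat_exact_iff_function_exact _).mpr fun f => ?_
    constructor
    · exact fun hf => exists_eval_eq H M fun t ht => congrFun hf fun k => ⟨t k, ht k⟩
    · rintro ⟨η, rfl⟩
      exact congrArg (fun φ => (φ.f i).hom η) (relCochainsIncl_comp_cochainsRes H M)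
  · exact (ModuleCat.mono_iff_injective _).mpr relBar.eval_injective
  · exact groupCohomology.cochainsMap_f_map_epi _ _ H.subtype_injective i

/-- The relative cohomology `Hⁱ(G, H; M(G/e))`. -/
def relCohomology (i : ℕ) : ModuleCat.{0} ℤ := (relCochains H M).homology i

namespace relCohomology

/-- The map from relative to absolute cohomology. -/
def toGroup (i : ℕ) : relCohomology H M i ⟶ groupCohomology M.atE i :=
  HomologicalComplex.homologyMap (relCochainsIncl H M) i

/-- The connecting homomorphism of the pair `(G, H)`. -/
def δ (i : ℕ) : groupCohomology (Rep.res H.subtype M.atE) i ⟶ relCohomology H M (i + 1) :=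
  (relCochains_shortExact H M).δ i (i + 1) rfl

theorem exact_toGroup_res (i : ℕ) :
    Function.Exact (toGroup H M i).hom (groupCohomologyRes H M.atE i).hom :=
  (ShortComplex.ShortExact.moduleCat_exact_iff_function_exact _).mp
    ((relCochains_shortExact H M).homology_exact₂ i)

theorem exact_res_δ (i : ℕ) :
    Function.Exact (groupCohomologyRes H M.atE i).hom (δ H M i).hom :=
  (ShortComplex.ShortExact.moduleCat_exact_iff_function_exact _).mp
    ((relCochains_shortExact H M).homology_exact₃ i (i + 1) rfl)

theorem exact_δ_toGroup (i : ℕ) :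
    Function.Exact (δ H M i).hom (toGroup H M (i + 1)).hom :=
  (ShortComplex.ShortExact.moduleCat_exact_iff_function_exact _).mp
    ((relCochains_shortExact H M).homology_exact₁ i (i + 1) rfl)

end relCohomology

theorem isZero_relBar_zero : IsZero (relBar (tuplesIn H) 0) := by
  refine (IsZero.iff_id_eq_zero _).mpr (relBar.hom_ext fun t ht => ?_)
  exact (ht fun k => k.elim0).elim

theorem subsingleton_relCohomology_zero : Subsingleton (relCohomology H M 0) := by
  refine ModuleCat.isZero_iff_subsingleton.mp ?_
  refine ShortComplex.isZero_homology_of_isZero_X₂ _ ?_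
  refine (IsZero.iff_id_eq_zero _).mpr (ConcreteCategory.hom_ext _ _ fun η => ?_)
  exact (isZero_relBar_zero H).eq_of_src (η : relBar (tuplesIn H) 0 ⟶ M) _

theorem groupCohomologyRes_zero_injective :
    Function.Injective (groupCohomologyRes H M.atE 0).hom := by
  refine (injective_iff_map_eq_zero _).mpr fun x hx => ?_
  obtain ⟨y, rfl⟩ := (relCohomology.exact_toGroup_res H M 0 x).mp hx
  have := subsingleton_relCohomology_zero H M
  rw [Subsingleton.elim y 0, map_zero]

/-- The projection onto the relative bar complex of the complex which differs from it only in
degree zero. -/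
def relComplexToRelBar : relComplex H ⟶ relBar.complex (faceClosed_tuplesIn H) where
  f
    | 0 => 0
    | i + 1 => 𝟙 ((relBar.complex (faceClosed_tuplesIn H)).X (i + 1))
  comm' i j hij := by
    obtain rfl : j + 1 = i := hij
    cases j with
    | zero => exact (isZero_relBar_zero H).eq_of_tgt _ _
    | succ j => exact (Category.id_comp _).trans (Category.comp_id _).symm

theorem isIso_linearYonedaMap_relComplexToRelBar (i : ℕ) :
    IsIso ((linearYonedaMap (relComplexToRelBar H) M).f (i + 1)) := by
  have : (linearYonedaMap (relComplexToRelBar H) M).f (i + 1) =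
      𝟙 ((relCochains H M).X (i + 1)) := by
    refine ConcreteCategory.hom_ext _ _ fun (η : relBar (tuplesIn H) (i + 1) ⟶ M) => ?_
    exact Category.id_comp η
  rw [this]
  exact IsIso.id _

variable {H} (hH : ∀ K : OrbitCat G, IsEmpty (K ⟶ OrbitCat.free G) →
    Subsingleton (K ⟶ (⟨H⟩ : OrbitCat G)))
  (P : ProjectiveResolution (orbitSupport H))

namespace relCohomology

/-- The comparison of relative cohomology with the derived functors of `Hom(-, M)` at
`orbitSupport H`. -/
def toExt (i : ℕ) : relCohomology H M i ⟶ (P.complex.linearYonedaObj ℤ M).homology i :=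
  HomologicalComplex.homologyMap (linearYonedaMap (relComplexToRelBar H) M) i ≫
    (linearYonedaHomologyIso ((relResolution hH).homotopyEquiv P) M i).hom

theorem isIso_toExt (i : ℕ) : IsIso (toExt M hH P (i + 2)) := by
  have := isIso_homologyMap_add_two _ (isIso_linearYonedaMap_relComplexToRelBar H M) i
  exact IsIso.comp_isIso' this (Iso.isIso_hom _)

theorem toExt_one_surjective : Function.Surjective (toExt M hH P 1).hom := by
  have := epi_homologyMap_one _ (isIso_linearYonedaMap_relComplexToRelBar H M 0)
    (isIso_linearYonedaMap_relComplexToRelBar H M 1)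
  exact (ModuleCat.epi_iff_surjective _).mp
    (epi_comp' this (@IsIso.epi_of_iso _ _ _ _ _ (Iso.isIso_hom _)))

/-- In degrees at least two, relative cohomology is the cohomology of `Hom(P, M)` for every
projective resolution `P` of `orbitSupport H`. -/
def extIso (i : ℕ) :
    relCohomology H M (i + 2) ≅ (P.complex.linearYonedaObj ℤ M).homology (i + 2) :=
  have := isIso_toExt M hH P i
  asIso (toExt M hH P (i + 2))

end relCohomology

end RelativeCohomology

/-! ### Vanishing of group cohomology by averaging -/

section Averaging

section ContractNth

variable {α : Type*} (op : α → α → α) {i : ℕ}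

theorem contractNth_castSucc_snoc (t : Fin (i + 1) → α) (x : α) {j : Fin (i + 1)}
    (hj : j ≠ Fin.last i) :
    Fin.contractNth j.castSucc op (Fin.snoc t x : Fin (i + 2) → α) =
      Fin.snoc (Fin.contractNth j op t) x := by
  have hj' : (j : ℕ) < i := Fin.val_lt_last hj
  funext k
  refine Fin.lastCases ?_ (fun k => ?_) k
  · simp [Fin.contractNth, hj'.not_gt, hj'.ne']
  · have : k.castSucc.succ = k.succ.castSucc := rfl
    simp only [Fin.contractNth, Fin.snoc_castSucc, Fin.val_castSucc, this]

theorem contractNth_castSucc_last_snoc (t : Fin (i + 1) → α) (x : α) :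
    Fin.contractNth (Fin.last i).castSucc op (Fin.snoc t x : Fin (i + 2) → α) =
      Fin.snoc (Fin.contractNth (Fin.last i) op t) (op (t (Fin.last i)) x) := by
  funext k
  refine Fin.lastCases ?_ (fun k => ?_) k <;> simp [Fin.contractNth]

theorem contractNth_last_snoc (t : Fin i → α) (x : α) :
    Fin.contractNth (Fin.last i) op (Fin.snoc t x : Fin (i + 1) → α) = t := by
  funext k
  simp [Fin.contractNth]

end ContractNth

open groupCohomology

variable {G : Type} [Group G] {V : Rep.{0} ℤ G} {i : ℕ}

theorem inhomogeneousCochains_d_apply (f : (Fin i → G) → V) (t : Fin (i + 1) → G) :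
    (inhomogeneousCochains.d V i).hom f t = V.ρ (t 0) (f (Fin.tail t)) +
      ∑ j : Fin (i + 1), (((-1 : ℤ) ^ ((j : ℕ) + 1)) • f (Fin.contractNth j (· * ·) t) : V) := by
  rw [inhomogeneousCochains.d_hom_apply]
  exact congrArg _ (Finset.sum_congr rfl fun j _ => int_smul_eq_zsmul _ _ _)

/-- The sum of a cochain over its last argument. -/
def sumLast [Fintype G] (f : (Fin (i + 1) → G) → V) (s : Fin i → G) : V :=
  ∑ x, f (Fin.snoc s x)

theorem sum_contractNth_snoc [Fintype G] (f : (Fin (i + 1) → G) → V) (t : Fin (i + 1) → G)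
    (j : Fin (i + 1)) :
    ∑ x, f (Fin.contractNth j.castSucc (· * ·) (Fin.snoc t x : Fin (i + 2) → G)) =
      sumLast f (Fin.contractNth j (· * ·) t) := by
  rcases eq_or_ne j (Fin.last i) with rfl | hj
  · simp only [contractNth_castSucc_last_snoc]
    exact Fintype.sum_equiv (Equiv.mulLeft (t (Fin.last i))) _ _ fun x => rfl
  · simp only [contractNth_castSucc_snoc _ _ _ hj]
    rfl

theorem d_apply_snoc (f : (Fin (i + 1) → G) → V) (t : Fin (i + 1) → G) (x : G) :
    (inhomogeneousCochains.d V (i + 1)).hom f (Fin.snoc t x) =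
      V.ρ (t 0) (f (Fin.snoc (Fin.tail t) x)) +
        (∑ j : Fin (i + 1), (((-1 : ℤ) ^ ((j : ℕ) + 1)) •
          f (Fin.contractNth j.castSucc (· * ·) (Fin.snoc t x : Fin (i + 2) → G)) : V) +
        ((-1 : ℤ) ^ (i + 2) • f t : V)) := by
  have hzero : (Fin.snoc t x : Fin (i + 2) → G) 0 = t 0 := by
    rw [← Fin.castSucc_zero, Fin.snoc_castSucc]
  have htail : Fin.tail (Fin.snoc t x : Fin (i + 2) → G) = Fin.snoc (Fin.tail t) x := by
    rw [← Fin.cons_self_tail t, ← Fin.cons_snoc_eq_snoc_cons, Fin.tail_cons, Fin.tail_cons]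
  rw [inhomogeneousCochains_d_apply, hzero, htail, Fin.sum_univ_castSucc, contractNth_last_snoc]
  rfl

theorem sum_d_snoc [Fintype G] (f : (Fin (i + 1) → G) → V) (t : Fin (i + 1) → G) :
    ∑ x, ((inhomogeneousCochains.d V (i + 1)).hom f (Fin.snoc t x) : V) =
      ((inhomogeneousCochains.d V i).hom (sumLast f) t + (-1 : ℤ) ^ (i + 2) • Nat.card G • f t :
        V) := by
  rw [Finset.sum_congr rfl fun x _ => d_apply_snoc f t x, Finset.sum_add_distrib,
    Finset.sum_add_distrib, Finset.sum_comm, Finset.sum_const, Finset.card_univ,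
    ← Nat.card_eq_fintype_card, inhomogeneousCochains_d_apply, ← map_sum, ← add_assoc]
  refine congrArg₂ (· + ·) (congrArg _ (Finset.sum_congr rfl fun j _ => ?_))
    (smul_comm (Nat.card G) ((-1 : ℤ) ^ (i + 2)) (f t))
  rw [← Finset.smul_sum, sum_contractNth_snoc]

theorem d_sumLast_of_d_eq_zero [Fintype G] {f : (Fin (i + 1) → G) → V}
    (hf : (inhomogeneousCochains.d V (i + 1)).hom f = 0) :
    (inhomogeneousCochains.d V i).hom (sumLast f) = (-1 : ℤ) ^ (i + 1) • Nat.card G • f := by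
  funext t
  have h := sum_d_snoc f t
  rw [Finset.sum_eq_zero fun x _ => congrFun hf _] at h
  refine (eq_neg_of_add_eq_zero_left h.symm).trans ?_
  rw [← neg_zsmul, pow_succ _ (i + 1), mul_neg_one, neg_neg]
  rfl

theorem exists_d_eq_of_d_eq_zero [Finite G]
    (hV : Function.Bijective fun v : V => Nat.card G • v) {f : (Fin (i + 1) → G) → V}
    (hf : (inhomogeneousCochains.d V (i + 1)).hom f = 0) :
    ∃ F, (inhomogeneousCochains.d V i).hom F = f := by
  have := Fintype.ofFinite G
  choose F hF using fun s => hV.2 ((-1 : ℤ) ^ (i + 1) • sumLast f s)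
  have hF' : Nat.card G • F = (-1 : ℤ) ^ (i + 1) • sumLast f := funext hF
  refine ⟨F, funext fun t => hV.1 ?_⟩
  suffices h : Nat.card G • (inhomogeneousCochains.d V i).hom F = Nat.card G • f from congrFun h t
  rw [← map_nsmul, hF', map_zsmul, d_sumLast_of_d_eq_zero hf, smul_smul, ← mul_pow]
  simp

theorem subsingleton_groupCohomology_of_bijective_nsmul [Finite G]
    (hV : Function.Bijective fun v : V => Nat.card G • v) (i : ℕ) :
    Subsingleton (groupCohomology V (i + 1)) := by
  refine ModuleCat.isZero_iff_subsingleton.mp ?_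
  change IsZero ((inhomogeneousCochains V).homology (i + 1))
  rw [← HomologicalComplex.exactAt_iff_isZero_homology,
    HomologicalComplex.exactAt_iff' _ i (i + 1) (i + 2) (by simp) (by simp),
    ShortComplex.ShortExact.moduleCat_exact_iff_function_exact]
  intro f
  change ((inhomogeneousCochains V).d (i + 1) (i + 2)).hom f = 0 ↔
    ∃ F, ((inhomogeneousCochains V).d i (i + 1)).hom F = f
  rw [inhomogeneousCochains.d_def, inhomogeneousCochains.d_def]
  constructor
  · exact exists_d_eq_of_d_eq_zero hV
  · rintro ⟨F, rfl⟩
    exact ConcreteCategory.congr_hom (inhomogeneousCochains.d_comp_d i V) F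

end Averaging

theorem relCohomology.subsingleton_of_bijective_nsmul {G : Type} [Group G] [Finite G]
    (H : Subgroup G) {M : CoeffSystem G}
    (hM : Function.Bijective fun v : M.atE => Nat.card G • v) (i : ℕ) :
    Subsingleton (relCohomology H M (i + 2)) := by
  have hMH : Function.Bijective fun v : M.atE => Nat.card H • v := by
    rw [← H.index_mul_card] at hM
    constructor
    · exact Function.Injective.of_comp (f := fun v : M.atE => H.index • v)
        (by simpa only [mul_nsmul', Function.comp_def] using hM.1)
    · exact Function.Surjective.of_comp (g := fun v : M.atE => H.index • v)
        (by simpa only [mul_nsmul, Function.comp_def] using hM.2)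
  have hG := subsingleton_groupCohomology_of_bijective_nsmul hM (i + 1)
  have hH : Subsingleton (groupCohomology (Rep.res H.subtype M.atE) (i + 1)) :=
    subsingleton_groupCohomology_of_bijective_nsmul hMH i
  refine subsingleton_of_forall_eq 0 fun x => ?_
  obtain ⟨y, rfl⟩ := (exact_δ_toGroup H M (i + 1) x).mp (Subsingleton.elim _ _)
  rw [Subsingleton.elim y 0, map_zero]

section MProfinite

theorem bijective_nsmul_of_coprime {A : Type*} [AddCommGroup A] {m k : ℕ} (h : Nat.Coprime m k)
    (hA : ∀ x : A, ∃ j : ℕ, m ^ j • x = 0) : Function.Bijective fun x : A => k • x := by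
  have exists_inverse (x : A) : ∃ u : ℤ, u • k • x = x := by
    obtain ⟨j, hj⟩ := hA x
    obtain ⟨a, b, hab⟩ := Nat.isCoprime_iff_coprime.mpr (h.pow_left j)
    refine ⟨b, ?_⟩
    have : (a * ((m ^ j : ℕ) : ℤ) + b * (k : ℤ)) • x = x := by rw [hab, one_zsmul]
    rwa [add_zsmul, mul_zsmul, mul_zsmul, natCast_zsmul, natCast_zsmul, hj, zsmul_zero,
      zero_add] at this
  constructor
  · refine (injective_iff_map_eq_zero (nsmulAddMonoidHom (α := A) k)).mpr fun x hx => ?_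
    obtain ⟨u, hu⟩ := exists_inverse x
    rw [← hu, show k • x = 0 from hx, zsmul_zero]
  · intro x
    obtain ⟨u, hu⟩ := exists_inverse x
    exact ⟨u • x, (smul_comm k u x).trans hu⟩

theorem bijective_nsmul_limit {I : Type} [Category.{0} I] (F : I ⥤ AddCommGrpCat.{0}) {k : ℕ}
    (hF : ∀ j, Function.Bijective fun x : F.obj j => k • x) :
    Function.Bijective fun x : (limit F : AddCommGrpCat) => k • x := by
  let μ : F ⟶ F :=
    { app := fun j => AddCommGrpCat.ofHom (nsmulAddMonoidHom k)
      naturality := fun i j f => by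
        ext x
        exact (map_nsmul (F.map f).hom k x).symm }
  have hμ (j : I) : IsIso (μ.app j) := (ConcreteCategory.isIso_iff_bijective _).mpr (hF j)
  have : IsIso μ := NatIso.isIso_of_isIso_app μ
  have limMap_eq (x : (limit F : AddCommGrpCat)) : limMap μ x = k • x := by
    refine Concrete.limit_ext _ _ _ fun j => ?_
    refine (ConcreteCategory.congr_hom (limMap_π μ j) x).trans ?_
    exact (map_nsmul (limit.π F j).hom k x).symm
  rw [← funext limMap_eq]
  exact (ConcreteCategory.isIso_iff_bijective _).mp inferInstance

theorem IsMProfinite.bijective_nsmul {m k : ℕ} {B : Type} [AddCommGroup B]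
    (hB : IsMProfinite m B) (h : Nat.Coprime m k) : Function.Bijective fun x : B => k • x := by
  obtain ⟨I, _, _, _, F, hF, ⟨e⟩⟩ := hB
  have hl := bijective_nsmul_limit F fun j => bijective_nsmul_of_coprime h (hF j)
  let e' : B ≃+ (limit F : AddCommGrpCat) := e.addCommGroupIsoToAddEquiv
  have : (fun x : B => k • x) = e'.symm ∘ (fun x => k • x) ∘ e' := by
    funext x
    simp
  rw [this]
  exact e'.symm.bijective.comp (hl.comp e'.bijective)

end MProfinite

/-! ### Bredon chains are projective -/

section FixedPoints

open MulAction

variable {G : Type} [Group G] {Y : Type} [MulAction G Y]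

/-- An orbit of a `G`-set as an object of the orbit category, through the stabilizer of the chosen
representative `Quotient.out a`. -/
def orbitOf (a : orbitRel.Quotient G Y) : OrbitCat G :=
  ⟨stabilizer G (Quotient.out a)⟩

/-- The fixed point given by a morphism to an orbit of a `G`-set. -/
def fixedPointOfHom {K : OrbitCat G} (a : orbitRel.Quotient G Y) (φ : K ⟶ orbitOf a) :
    fixedPoints K.sub Y :=
  ⟨ofQuotientStabilizer G (Quotient.out a) (OrbitCat.imageOne φ), fun k =>
    (ofQuotientStabilizer_smul G _ _ _).symm.trans
      (congrArg _ (OrbitCat.smul_imageOne φ k.2))⟩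

theorem coe_fixedPointOfHom {K : OrbitCat G} {a : orbitRel.Quotient G Y} {φ : K ⟶ orbitOf a}
    {g : G} (hg : OrbitCat.imageOne φ = (g : G ⧸ (orbitOf a).sub)) :
    (fixedPointOfHom a φ : Y) = g • Quotient.out a :=
  congrArg (ofQuotientStabilizer G (Quotient.out a)) hg

theorem mem_orbit_out_iff {a : orbitRel.Quotient G Y} {y : Y} :
    y ∈ orbit G (Quotient.out a) ↔ Quotient.mk'' y = a := by
  rw [← orbitRel.Quotient.orbit_eq_orbit_out a Quotient.out_eq', orbitRel.Quotient.mem_orbit]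

theorem fixedPointOfHom_bijective (K : OrbitCat G) :
    Function.Bijective fun x : Σ a : orbitRel.Quotient G Y, K ⟶ orbitOf a =>
      fixedPointOfHom x.1 x.2 := by
  constructor
  · rintro ⟨a, φ⟩ ⟨b, ψ⟩ h
    have h : ofQuotientStabilizer G (Quotient.out a) (OrbitCat.imageOne φ) =
        ofQuotientStabilizer G (Quotient.out b) (OrbitCat.imageOne ψ) := congrArg Subtype.val h
    obtain rfl : a = b := by
      rw [← mem_orbit_out_iff.mp (ofQuotientStabilizer_mem_orbit G _ (OrbitCat.imageOne φ)), h]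
      exact mem_orbit_out_iff.mp (ofQuotientStabilizer_mem_orbit G _ _)
    rw [OrbitCat.imageOne_injective (injective_ofQuotientStabilizer G _ h)]
  · rintro ⟨y, hy⟩
    let a : orbitRel.Quotient G Y := Quotient.mk'' y
    obtain ⟨g, hg : g • Quotient.out a = y⟩ := mem_orbit_out_iff.mpr (rfl : Quotient.mk'' y = a)
    have hfix (k : G) (hk : k ∈ K.sub) :
        k • (g : G ⧸ (orbitOf a).sub) = (g : G ⧸ (orbitOf a).sub) := by
      refine injective_ofQuotientStabilizer G (Quotient.out a) ?_
      change (k * g) • Quotient.out a = g • Quotient.out a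
      rw [mul_smul, hg]
      exact hy ⟨k, hk⟩
    refine ⟨⟨a, OrbitCat.homMk _ hfix⟩, Subtype.ext ?_⟩
    exact (coe_fixedPointOfHom (OrbitCat.imageOne_homMk _ hfix)).trans hg

/-- The presheaf of fixed points of a `G`-set is the disjoint union of the presheaves represented
by its orbits. -/
def fixedPointsEquiv (K : OrbitCat G) :
    (Σ a : orbitRel.Quotient G Y, K ⟶ orbitOf a) ≃ fixedPoints K.sub Y :=
  Equiv.ofBijective _ (fixedPointOfHom_bijective K)

end FixedPoints

section ChainBasis

open Simplicial

variable (T : SSet.{0}) (n : ℕ)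

/-- A simplex as an integral chain. -/
def chainMk {T : SSet.{0}} {n : ℕ} (x : T _⦋n⦌) : (T.chainComplex (ModuleCat.of ℤ ℤ)).X n :=
  (T.ιChainComplex (R := ModuleCat.of ℤ ℤ) x).hom (1 : ℤ)

theorem chainMap_chainMk {T T' : SSet.{0}} (f : T ⟶ T') {n : ℕ} (x : T _⦋n⦌) :
    (SSet.chainComplexMap f (ModuleCat.of ℤ ℤ)).f n (chainMk x) = chainMk (f.app _ x) :=
  ConcreteCategory.congr_hom (SSet.ι_chainComplexMap_f T T' f (ModuleCat.of ℤ ℤ) x) (1 : ℤ)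

/-- The basis of the integral chains of a simplicial set given by the simplices. -/
def chainBasis : Module.Basis (T _⦋n⦌) ℤ ((T.chainComplex (ModuleCat.of ℤ ℤ)).X n) :=
  have := Classical.decEq (T _⦋n⦌)
  .ofRepr ((ModuleCat.coprodIsoDirectSum fun _ : T _⦋n⦌ => ModuleCat.of ℤ ℤ).toLinearEquiv.trans
    (finsuppLEquivDirectSum ℤ ℤ (T _⦋n⦌)).symm)

theorem chainBasis_apply (x : T _⦋n⦌) : chainBasis T n x = chainMk x := by
  classical
  rw [Module.Basis.apply_eq_iff]
  refine (LinearEquiv.symm_apply_eq _).mpr ?_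
  refine (ConcreteCategory.congr_hom (ModuleCat.ι_coprodIsoDirectSum_hom
    (fun _ : T _⦋n⦌ => ModuleCat.of ℤ ℤ) x) (1 : ℤ)).trans ?_
  exact (finsuppLEquivDirectSum_single ℤ ℤ _ x 1).symm

theorem chainBasis_reindex_apply {ι : Type} (e : T _⦋n⦌ ≃ ι) (i : ι) :
    (chainBasis T n).reindex e i = chainMk (e.symm i) := by
  rw [Module.Basis.reindex_apply, chainBasis_apply]

end ChainBasis

section BredonProjective

open Simplicial

variable {G : Type} [Group G] (X : Type) [MulAction G X] [TopologicalSpace X]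
  [ContinuousConstSMul G X]

/-- The singular `n`-simplices of the fixed points of the isotropy group of an orbit. -/
abbrev fixedSimplices (n : ℕ) (K : OrbitCat G) : Type :=
  (TopCat.toSSet.obj ((fixedPointsFunctor X).obj (op K))) _⦋n⦌

/-- The singular simplices of the fixed points are the fixed points of the singular simplices. -/
def fixedSimplicesEquiv (n : ℕ) (K : OrbitCat G) : fixedSimplices X n K ≃
    MulAction.fixedPoints K.sub C(SimplexCategory.toTop.{0}.obj ⦋n⦌, X) where
  toFun s := ⟨⟨fun z => (s.down.hom z).1, continuous_subtype_val.comp s.down.hom.continuous⟩,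
    fun k => ContinuousMap.ext fun z => (s.down.hom z).2 k⟩
  invFun f := ⟨TopCat.ofHom ⟨fun z => ⟨f.1 z, fun k => congrArg (· z) (f.2 k)⟩,
    f.1.continuous.subtype_mk _⟩⟩
  left_inv _ := rfl
  right_inv _ := rfl

theorem fixedSimplicesEquiv_symm_fixedPointOfHom (n : ℕ) {K : OrbitCat G}
    (a : MulAction.orbitRel.Quotient G C(SimplexCategory.toTop.{0}.obj ⦋n⦌, X))
    (φ : K ⟶ orbitOf a) :
    (fixedSimplicesEquiv X n K).symm (fixedPointOfHom a φ) =
      (TopCat.toSSet.map ((fixedPointsFunctor X).map φ.op)).app (op ⦋n⦌)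
        ((fixedSimplicesEquiv X n _).symm ⟨Quotient.out a, fun k => k.2⟩) := by
  refine (Equiv.symm_apply_eq _).mpr (Subtype.ext (ContinuousMap.ext fun z => ?_))
  obtain ⟨g, hg⟩ := QuotientGroup.mk_surjective (OrbitCat.imageOne φ)
  refine (congrArg (· z) (coe_fixedPointOfHom hg.symm)).trans ?_
  change g • (Quotient.out a) z = orbitMap X _ (OrbitCat.imageOne φ)
  rw [← hg]
  rfl

/-- The Bredon chains are free on the orbits of singular simplices of `X`. -/
def bredonChainsBasis (n : ℕ) : PresheafBasis ((bredonChains (G := G) X).X n)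
    (orbitOf : MulAction.orbitRel.Quotient G C(SimplexCategory.toTop.{0}.obj ⦋n⦌, X) → _) where
  gen a := chainMk ((fixedSimplicesEquiv X n _).symm ⟨Quotient.out a, fun k => k.2⟩)
  basis K := (chainBasis (TopCat.toSSet.obj ((fixedPointsFunctor X).obj (op K))) n).reindex
    ((fixedSimplicesEquiv X n K).trans (fixedPointsEquiv K).symm)
  basis_apply K a φ := by
    refine (chainBasis_reindex_apply _ _ _ _).trans ?_
    refine (congrArg chainMk (fixedSimplicesEquiv_symm_fixedPointOfHom X n a φ)).trans ?_
    exact (chainMap_chainMk (TopCat.toSSet.map ((fixedPointsFunctor X).map φ.op)) _).symm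

theorem bredonChains_projective (n : ℕ) : Projective ((bredonChains (G := G) X).X n) :=
  (bredonChainsBasis X n).projective

end BredonProjective

/-! ### Contractibility of the infinite join -/

section JoinContractible

open scoped unitInterval

theorem homotopic_fixedPoints {M Y : Type*} [Monoid M] [MulAction M Y] [TopologicalSpace Y]
    {h : Y → I → Y} (hc : Continuous fun p : Y × I => h p.1 p.2)
    (hM : ∀ (k : M) x u, k • h x u = h (k • x) u)
    {f g : C(MulAction.fixedPoints M Y, MulAction.fixedPoints M Y)}
    (hf : ∀ x : MulAction.fixedPoints M Y, h x 0 = f x)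
    (hg : ∀ x : MulAction.fixedPoints M Y, h x 1 = g x) : f.Homotopic g :=
  ⟨{toFun p := ⟨h p.2 p.1, fun k => by rw [hM, p.2.2 k]⟩
    continuous_toFun := (hc.comp
      ((continuous_subtype_val.comp continuous_snd).prodMk continuous_fst)).subtype_mk _
    map_zero_left x := Subtype.ext (hf x)
    map_one_left x := Subtype.ext (hg x) }⟩

namespace InfiniteJoin

variable {S : Type}

theorem exists_stage (x : InfiniteJoin S) : ∃ N, ∀ v, N ≤ v.1 → x.weight v = 0 := by
  refine ⟨x.weight.support.sup (fun v => v.1 + 1), fun v hv => ?_⟩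
  by_contra h
  exact absurd hv (Nat.not_le.mpr (Finset.le_sup (f := fun v : ℕ × S => v.1 + 1)
    (Finsupp.mem_support_iff.mpr h)))

theorem continuous_stage_incl (N : ℕ) : Continuous fun x : Stage S N => x.1 :=
  continuous_iSup_rng (i := N) continuous_coinduced_rng

theorem continuous_stage_weight (N : ℕ) (v : ℕ × S) :
    Continuous fun x : Stage S N => x.1.weight v :=
  (continuous_apply v).comp continuous_induced_dom

/-- Since `I` is locally compact, a homotopy may be tested on the finite stages of the join. -/
theorem continuous_of_stages {h : InfiniteJoin S → I → InfiniteJoin S} (b : ℕ → ℕ)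
    (hb : ∀ N x u, (∀ v, N ≤ v.1 → x.weight v = 0) → ∀ v, b N ≤ v.1 → (h x u).weight v = 0)
    (hc : ∀ N v, Continuous fun p : Stage S N × I => (h p.1.1 p.2).weight v) :
    Continuous fun p : InfiniteJoin S × I => h p.1 p.2 := by
  have continuous_on_stage (N : ℕ) : Continuous fun p : Stage S N × I => h p.1.1 p.2 := by
    let f : Stage S N × I → Stage S (b N) := fun p => ⟨h p.1.1 p.2, hb N _ _ p.1.2⟩
    have hf : Continuous f := continuous_induced_rng.mpr (continuous_pi fun v => hc N v)
    exact (continuous_stage_incl (b N)).comp hf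
  have continuous_path (x : InfiniteJoin S) : Continuous (h x) := by
    obtain ⟨N, hx⟩ := exists_stage x
    let x' : Stage S N := ⟨x, hx⟩
    exact (continuous_on_stage N).comp (Continuous.prodMk_right x')
  let F : InfiniteJoin S → C(I, InfiniteJoin S) := fun x => ⟨h x, continuous_path x⟩
  have hF : Continuous F := by
    refine continuous_iSup_dom.mpr fun N => continuous_coinduced_dom.mpr ?_
    exact ContinuousMap.continuous_of_continuous_uncurry _ (continuous_on_stage N)
  exact ContinuousMap.continuous_uncurry_of_continuous ⟨F, hF⟩

/-- A continuous function which increases from `0` to `1` on `[1/(j+2), 1/(j+1)]`. These intervals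
meet only at end points, so at every time at most one of the ramps is strictly between `0` and
`1`. -/
def ramp (j : ℕ) (u : ℝ) : ℝ := max 0 (min 1 ((j + 1) * (j + 2) * u - (j + 1)))

theorem continuous_ramp (j : ℕ) : Continuous (ramp j) := by
  unfold ramp
  fun_prop

theorem ramp_nonneg (j : ℕ) (u : ℝ) : 0 ≤ ramp j u := le_max_left _ _

theorem ramp_le_one (j : ℕ) (u : ℝ) : ramp j u ≤ 1 := max_le zero_le_one (min_le_left _ _)

theorem ramp_zero (j : ℕ) : ramp j 0 = 0 := by
  refine max_eq_left (min_le_of_right_le ?_)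
  have : (0 : ℝ) ≤ j := j.cast_nonneg
  linarith

theorem ramp_one (j : ℕ) : ramp j 1 = 1 := by
  have : (0 : ℝ) ≤ j := j.cast_nonneg
  unfold ramp
  rw [min_eq_left (by nlinarith), max_eq_right zero_le_one]

theorem ramp_succ_eq_one {j : ℕ} {u : ℝ} (h : ramp j u ≠ 0) : ramp (j + 1) u = 1 := by
  have hj : (0 : ℝ) < j + 1 := j.cast_add_one_pos
  have ramp_arg_pos : 0 < (j + 1) * (j + 2) * u - ((j : ℝ) + 1) := by
    by_contra hneg
    exact h (max_eq_left (min_le_of_right_le (not_lt.mp hneg)))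
  have one_lt : 1 < ((j : ℝ) + 2) * u :=
    lt_of_mul_lt_mul_left (by linarith) hj.le
  unfold ramp
  rw [min_eq_left, max_eq_right zero_le_one]
  push_cast
  nlinarith

/-- The linear map which moves the proportion `ramp j u` of the weight in the `j`-th copy to the
next copy. -/
def shiftWeight (u : ℝ) : (ℕ × S →₀ ℝ) →ₗ[ℝ] (ℕ × S →₀ ℝ) :=
  Finsupp.linearCombination ℝ fun v =>
    Finsupp.single v (1 - ramp v.1 u) + Finsupp.single (v.1 + 1, v.2) (ramp v.1 u)

theorem shiftWeight_zero_apply (u : ℝ) (w : ℕ × S →₀ ℝ) (s : S) :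
    shiftWeight u w (0, s) = (1 - ramp 0 u) * w (0, s) := by
  induction w using Finsupp.induction_linear with
  | zero => simp
  | add f g hf hg => simp [hf, hg, mul_add]
  | single v r =>
    obtain ⟨j, t⟩ := v
    classical
    simp only [shiftWeight, Finsupp.linearCombination_single, Finsupp.smul_apply,
      Finsupp.add_apply, Finsupp.single_apply, Prod.mk.injEq, smul_eq_mul]
    by_cases h : j = 0 ∧ t = s
    · obtain ⟨rfl, rfl⟩ := h
      simp [mul_comm]
    · simp [h]

theorem shiftWeight_succ_apply (u : ℝ) (w : ℕ × S →₀ ℝ) (i : ℕ) (s : S) :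
    shiftWeight u w (i + 1, s) = (1 - ramp (i + 1) u) * w (i + 1, s) + ramp i u * w (i, s) := by
  induction w using Finsupp.induction_linear with
  | zero => simp
  | add f g hf hg =>
    rw [map_add, Finsupp.add_apply, hf, hg, Finsupp.add_apply, Finsupp.add_apply]
    ring
  | single v r =>
    obtain ⟨j, t⟩ := v
    classical
    simp only [shiftWeight, Finsupp.linearCombination_single, Finsupp.smul_apply,
      Finsupp.add_apply, Finsupp.single_apply, Prod.mk.injEq, smul_eq_mul, add_left_inj]
    rcases eq_or_ne t s with rfl | hs
    · rcases eq_or_ne j i with rfl | hi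
      · simp [mul_comm]
      · rcases eq_or_ne j (i + 1) with rfl | hi'
        · simp [mul_comm]
        · simp [hi, hi']
    · simp [hs]

theorem sum_shiftWeight (u : ℝ) (w : ℕ × S →₀ ℝ) :
    ((shiftWeight u w).sum fun _ r => r) = w.sum fun _ r => r := by
  have sum_eq (w : ℕ × S →₀ ℝ) :
      (w.sum fun _ r => r) = Finsupp.linearCombination ℝ (fun _ => (1 : ℝ)) w := by
    simp [Finsupp.linearCombination_apply]
  rw [sum_eq, sum_eq]
  induction w using Finsupp.induction_linear with
  | zero => simp
  | add f g hf hg => simp only [map_add, hf, hg]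
  | single v r =>
    simp only [shiftWeight, Finsupp.linearCombination_single, map_smul, map_add, smul_eq_mul]
    ring

/-- The homotopy from the identity to the map which moves every copy to the next one. The copies
move one at a time, those of high index first, so that no two points of the same copy ever meet. -/
def shift (x : InfiniteJoin S) (u : I) : InfiniteJoin S where
  weight := shiftWeight u x.weight
  nonneg := by
    rintro ⟨_ | j, s⟩
    · rw [shiftWeight_zero_apply]
      exact mul_nonneg (sub_nonneg.mpr (ramp_le_one _ _)) (x.nonneg _)
    · rw [shiftWeight_succ_apply]
      exact add_nonneg (mul_nonneg (sub_nonneg.mpr (ramp_le_one _ _)) (x.nonneg _))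
        (mul_nonneg (ramp_nonneg _ _) (x.nonneg _))
  unique := by
    rintro (_ | j) s t hs ht
    · rw [shiftWeight_zero_apply] at hs ht
      exact x.unique 0 s t (right_ne_zero_of_mul hs) (right_ne_zero_of_mul ht)
    · rw [shiftWeight_succ_apply] at hs ht
      by_cases h : ramp j u = 0
      · rw [h, zero_mul, add_zero] at hs ht
        exact x.unique _ s t (right_ne_zero_of_mul hs) (right_ne_zero_of_mul ht)
      · rw [ramp_succ_eq_one h, sub_self, zero_mul, zero_add] at hs ht
        exact x.unique _ s t (right_ne_zero_of_mul hs) (right_ne_zero_of_mul ht)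
  sum_eq_one := (sum_shiftWeight _ _).trans x.sum_eq_one

theorem shift_weight_zero (x : InfiniteJoin S) (u : I) (s : S) :
    (shift x u).weight (0, s) = (1 - ramp 0 u) * x.weight (0, s) :=
  shiftWeight_zero_apply _ _ _

theorem shift_weight_succ (x : InfiniteJoin S) (u : I) (j : ℕ) (s : S) :
    (shift x u).weight (j + 1, s) =
      (1 - ramp (j + 1) u) * x.weight (j + 1, s) + ramp j u * x.weight (j, s) :=
  shiftWeight_succ_apply _ _ _ _

theorem shift_zero (x : InfiniteJoin S) : shift x 0 = x := by
  ext ⟨_ | j, s⟩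
  · simp [shift_weight_zero, ramp_zero]
  · simp [shift_weight_succ, ramp_zero]

theorem shift_one_weight_zero (x : InfiniteJoin S) (s : S) : (shift x 1).weight (0, s) = 0 := by
  simp [shift_weight_zero, ramp_one]

theorem shift_weight_eq_zero {N : ℕ} {x : InfiniteJoin S} (hx : ∀ v, N ≤ v.1 → x.weight v = 0)
    (u : I) : ∀ v, N + 1 ≤ v.1 → (shift x u).weight v = 0 := by
  rintro ⟨_ | j, s⟩ hv
  · exact absurd hv (by simp)
  · have hj : N ≤ j := Nat.le_of_succ_le_succ hv
    rw [shift_weight_succ, hx (j + 1, s) (hj.trans j.le_succ), hx (j, s) hj, mul_zero, mul_zero,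
      add_zero]

theorem continuous_shift_weight (N : ℕ) (v : ℕ × S) :
    Continuous fun p : Stage S N × I => (shift p.1.1 p.2).weight v := by
  have hr (j : ℕ) : Continuous fun p : Stage S N × I => ramp j p.2 :=
    (continuous_ramp j).comp (continuous_subtype_val.comp continuous_snd)
  have hw (v : ℕ × S) : Continuous fun p : Stage S N × I => p.1.1.weight v :=
    (continuous_stage_weight N v).comp continuous_fst
  obtain ⟨_ | j, s⟩ := v
  · simp only [shift_weight_zero]
    exact (continuous_const.sub (hr 0)).mul (hw _)
  · simp only [shift_weight_succ]
    exact ((continuous_const.sub (hr (j + 1))).mul (hw _)).add ((hr j).mul (hw _))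

theorem continuous_shift : Continuous fun p : InfiniteJoin S × I => shift p.1 p.2 :=
  continuous_of_stages (· + 1) (fun _ _ u hx => shift_weight_eq_zero hx u) continuous_shift_weight

/-- The vertex `s` of the first copy of `S`. -/
def vertex (s : S) : InfiniteJoin S where
  weight := Finsupp.single (0, s) 1
  nonneg v := by
    classical
    rw [Finsupp.single_apply]
    split_ifs
    exacts [zero_le_one, le_rfl]
  unique i a b ha hb := by
    have ha' := Finsupp.single_apply_ne_zero.mp ha
    have hb' := Finsupp.single_apply_ne_zero.mp hb
    exact congrArg Prod.snd (ha'.1.trans hb'.1.symm)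
  sum_eq_one := Finsupp.sum_single_index rfl

theorem vertex_weight_succ (s t : S) (j : ℕ) : (vertex s).weight (j + 1, t) = 0 :=
  Finsupp.single_eq_of_ne (by simp)

/-- The segment between two points which lie in a common simplex. -/
def segment (x y : InfiniteJoin S)
    (hxy : ∀ i s t, x.weight (i, s) ≠ 0 → y.weight (i, t) ≠ 0 → s = t) (u : I) :
    InfiniteJoin S where
  weight := (1 - u : ℝ) • x.weight + (u : ℝ) • y.weight
  nonneg v := add_nonneg (mul_nonneg (sub_nonneg.mpr u.2.2) (x.nonneg v))
    (mul_nonneg u.2.1 (y.nonneg v))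
  unique i s t hs ht := by
    have ne_zero_or {v : ℕ × S} (hv : ((1 - u : ℝ) • x.weight + (u : ℝ) • y.weight) v ≠ 0) :
        x.weight v ≠ 0 ∨ y.weight v ≠ 0 := by
      contrapose! hv
      simp [hv]
    rcases ne_zero_or hs with hs | hs <;> rcases ne_zero_or ht with ht | ht
    · exact x.unique i s t hs ht
    · exact hxy i s t hs ht
    · exact (hxy i t s ht hs).symm
    · exact y.unique i s t hs ht
  sum_eq_one := by
    rw [Finsupp.sum_add_index' (fun _ => rfl) (fun _ _ _ => rfl),
      Finsupp.sum_smul_index fun _ => rfl, Finsupp.sum_smul_index fun _ => rfl,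
      ← Finsupp.mul_sum, ← Finsupp.mul_sum, x.sum_eq_one, y.sum_eq_one]
    ring

/-- The homotopy from the shift to the constant map at a vertex of the first copy, which the shift
has left empty. -/
def cone (s₀ : S) (x : InfiniteJoin S) (u : I) : InfiniteJoin S :=
  segment (shift x 1) (vertex s₀) (fun i s t hs ht => by
    cases i with
    | zero => exact absurd (shift_one_weight_zero x s) hs
    | succ j => exact absurd (vertex_weight_succ s₀ t j) ht) u

theorem cone_weight (s₀ : S) (x : InfiniteJoin S) (u : I) (v : ℕ × S) :
    (cone s₀ x u).weight v =
      (1 - (u : ℝ)) * (shift x 1).weight v + u * (vertex s₀).weight v :=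
  rfl

theorem continuous_cone (s₀ : S) :
    Continuous fun p : InfiniteJoin S × I => cone s₀ p.1 p.2 := by
  refine continuous_of_stages (· + 1) (fun N x u hx v hv => ?_) fun N v => ?_
  · obtain ⟨j, hj⟩ := Nat.exists_eq_add_of_le' ((Nat.le_add_left 1 N).trans hv)
    obtain ⟨_, s⟩ := v
    subst hj
    rw [cone_weight, shift_weight_eq_zero hx 1 _ hv, vertex_weight_succ, mul_zero, mul_zero,
      add_zero]
  · have hu : Continuous fun p : Stage S N × I => (p.2 : ℝ) :=
      continuous_subtype_val.comp continuous_snd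
    have hshift : Continuous fun p : Stage S N × I => (shift p.1.1 1).weight v :=
      (continuous_shift_weight N v).along_fst.comp continuous_fst
    simp only [cone_weight]
    exact ((continuous_const.sub hu).mul hshift).add (hu.mul continuous_const)

theorem cone_zero (s₀ : S) (x : InfiniteJoin S) : cone s₀ x 0 = shift x 1 := by
  ext v
  simp [cone_weight]

theorem cone_one (s₀ : S) (x : InfiniteJoin S) : cone s₀ x 1 = vertex s₀ := by
  ext v
  simp [cone_weight]

variable {G : Type} [Group G] [MulAction G S]

theorem smul_shift (g : G) (x : InfiniteJoin S) (u : I) : g • shift x u = shift (g • x) u := by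
  ext ⟨_ | j, s⟩
  · simp only [weight_smul, shift_weight_zero]
  · simp only [weight_smul, shift_weight_succ]

theorem smul_vertex (g : G) (s : S) : g • vertex s = vertex (g • s) :=
  InfiniteJoin.ext (Finsupp.equivMapDomain_single _ _ _)

theorem smul_cone (g : G) (s₀ : S) (x : InfiniteJoin S) (u : I) :
    g • cone s₀ x u = cone (g • s₀) (g • x) u := by
  ext ⟨j, s⟩
  rw [cone_weight, ← smul_shift, ← smul_vertex]
  rfl

theorem contractibleSpace_fixedPoints (K : Subgroup G) {s₀ : S} (hs : ∀ k ∈ K, k • s₀ = s₀) :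
    ContractibleSpace (MulAction.fixedPoints K (InfiniteJoin S)) := by
  have vertex_mem : vertex s₀ ∈ MulAction.fixedPoints K (InfiniteJoin S) := fun k =>
    (smul_vertex (k : G) s₀).trans (congrArg vertex (hs k k.2))
  let shiftOne : C(MulAction.fixedPoints K (InfiniteJoin S),
      MulAction.fixedPoints K (InfiniteJoin S)) :=
    { toFun := fun x => ⟨shift x 1, fun k => (smul_shift (k : G) x.1 1).trans
        (congrArg (shift · 1) (x.2 k))⟩
      continuous_toFun := (continuous_shift.comp
        (continuous_subtype_val.prodMk continuous_const)).subtype_mk _ }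
  have id_homotopic_shift : (ContinuousMap.id _).Homotopic shiftOne :=
    homotopic_fixedPoints continuous_shift (fun k : K => smul_shift (k : G))
      (fun x => shift_zero x.1) fun _ => rfl
  have shift_homotopic_const : shiftOne.Homotopic (ContinuousMap.const _ ⟨_, vertex_mem⟩) := by
    refine homotopic_fixedPoints (continuous_cone s₀) (fun (k : K) x u => ?_)
      (fun x => cone_zero s₀ x.1) fun x => cone_one s₀ x.1
    exact (smul_cone (k : G) s₀ x u).trans (congrArg (cone · _ u) (hs k k.2))
  exact (contractible_iff_id_nullhomotopic _).mpr
    ⟨_, id_homotopic_shift.trans shift_homotopic_const⟩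

end InfiniteJoin

end JoinContractible

/-! ### The Bredon chains of the infinite join -/

section SingularChains

open Simplicial AlgebraicTopology

variable (T : TopCat.{0})

/-- The integral singular chains of a space. -/
abbrev singularChains : ChainComplex (ModuleCat.{0} ℤ) ℕ :=
  (TopCat.toSSet.obj T).chainComplex (ModuleCat.of ℤ ℤ)

/-- The singular `0`-simplex at a point. -/
def singularVertex {T : TopCat.{0}} (x : T) : (TopCat.toSSet.obj T) _⦋0⦌ :=
  ⟨TopCat.ofHom (ContinuousMap.const _ x)⟩

/-- The chain map induced by the constant map of a space at one of its points. -/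
abbrev constChainMap (x : T) : singularChains T ⟶ singularChains T :=
  ((singularChainComplexFunctor (ModuleCat.{0} ℤ)).obj (ModuleCat.of ℤ ℤ)).map
    (TopCat.ofHom (ContinuousMap.const T x))

theorem exists_homotopy_constChainMap [ContractibleSpace T] :
    ∃ x : T, Nonempty (Homotopy (𝟙 (singularChains T)) (constChainMap T x)) := by
  obtain ⟨x, ⟨h⟩⟩ := (contractible_iff_id_nullhomotopic T).mp inferInstance
  have h : TopCat.Homotopy (𝟙 T) (TopCat.ofHom (ContinuousMap.const T x)) := h
  exact ⟨x, ⟨(Homotopy.ofEq (CategoryTheory.Functor.map_id _ _).symm).trans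
    (h.singularChainComplexFunctorObjMap (ModuleCat.of ℤ ℤ))⟩⟩

theorem homologyMap_constChainMap_succ (x : T) (n : ℕ) :
    HomologicalComplex.homologyMap (constChainMap T x) (n + 1) = 0 := by
  let F := (singularHomologyFunctor (ModuleCat.{0} ℤ) (n + 1)).obj (ModuleCat.of ℤ ℤ)
  let toPoint : T ⟶ TopCat.of PUnit := TopCat.ofHom (ContinuousMap.const T PUnit.unit)
  let fromPoint : TopCat.of PUnit ⟶ T := TopCat.ofHom (ContinuousMap.const PUnit x)
  have isZero_point : IsZero (F.obj (TopCat.of PUnit)) :=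
    isZero_singularHomologyFunctor_of_totallyDisconnectedSpace _ _ _ _ n.succ_ne_zero
  have map_const_eq_zero : F.map (toPoint ≫ fromPoint) = 0 := by
    rw [F.map_comp, isZero_point.eq_zero_of_tgt (F.map toPoint), zero_comp]
  exact map_const_eq_zero

theorem singularChains_exact_succ [ContractibleSpace T] (n : ℕ) :
    Function.Exact ((singularChains T).d (n + 2) (n + 1)) ((singularChains T).d (n + 1) n) := by
  obtain ⟨x, ⟨h⟩⟩ := exists_homotopy_constChainMap T
  have homologyMap_id_eq_zero :
      HomologicalComplex.homologyMap (𝟙 (singularChains T)) (n + 1) = 0 :=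
    (h.homologyMap_eq _).trans (homologyMap_constChainMap_succ T x n)
  have exactAt : (singularChains T).ExactAt (n + 1) := by
    rw [HomologicalComplex.exactAt_iff_isZero_homology, IsZero.iff_id_eq_zero,
      ← HomologicalComplex.homologyMap_id, homologyMap_id_eq_zero]
  rw [HomologicalComplex.exactAt_iff' _ (n + 2) (n + 1) n (by simp) (by simp)] at exactAt
  exact (ShortComplex.ShortExact.moduleCat_exact_iff_function_exact _).mp exactAt

theorem singularChains_d_chainMk (s : (TopCat.toSSet.obj T) _⦋1⦌) :
    (singularChains T).d 1 0 (chainMk s) =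
      chainMk ((TopCat.toSSet.obj T).δ 0 s) - chainMk ((TopCat.toSSet.obj T).δ 1 s) := by
  refine (ConcreteCategory.congr_hom
    ((TopCat.toSSet.obj T).ιChainComplex_d (R := ModuleCat.of ℤ ℤ) s) (1 : ℤ)).trans ?_
  rw [Fin.sum_univ_two]
  simp only [Fin.val_zero, Fin.val_one, pow_zero, pow_one, one_smul, neg_smul, ← sub_eq_add_neg]
  rfl

/-- The degree of a singular `0`-chain, the sum of its coefficients. -/
def zeroChainDegree : (singularChains T).X 0 →ₗ[ℤ] ℤ :=
  (chainBasis (TopCat.toSSet.obj T) 0).constr ℤ fun _ => 1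

theorem zeroChainDegree_chainMk (s : (TopCat.toSSet.obj T) _⦋0⦌) :
    zeroChainDegree T (chainMk s) = 1 := by
  rw [← chainBasis_apply]
  exact Module.Basis.constr_basis _ _ _ _

theorem zeroChainDegree_surjective [Nonempty T] : Function.Surjective (zeroChainDegree T) := by
  intro k
  refine ⟨LinearMap.toSpanSingleton ℤ _ (chainMk (singularVertex (Classical.arbitrary T))) k, ?_⟩
  refine ((zeroChainDegree T).map_smul k _).trans ?_
  rw [zeroChainDegree_chainMk, smul_eq_mul, mul_one]

theorem constChainMap_f_zero (x : T) : ((constChainMap T x).f 0).hom =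
    (LinearMap.toSpanSingleton ℤ _ (chainMk (singularVertex x))).comp (zeroChainDegree T) := by
  refine (chainBasis _ 0).ext fun s => ?_
  rw [chainBasis_apply, LinearMap.comp_apply, zeroChainDegree_chainMk]
  exact (chainMap_chainMk _ _).trans (LinearMap.toSpanSingleton_apply_one ℤ _ _).symm

theorem singularChains_exact_zeroChainDegree [ContractibleSpace T] :
    Function.Exact ((singularChains T).d 1 0).hom (zeroChainDegree T) := by
  have degree_comp_d : (zeroChainDegree T).comp ((singularChains T).d 1 0).hom = 0 := by
    refine (chainBasis _ 1).ext fun s => ?_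
    rw [chainBasis_apply]
    refine (congrArg (zeroChainDegree T) (singularChains_d_chainMk T s)).trans ?_
    rw [map_sub, zeroChainDegree_chainMk, zeroChainDegree_chainMk, sub_self, LinearMap.zero_apply]
  obtain ⟨x, ⟨h⟩⟩ := exists_homotopy_constChainMap T
  refine fun z => ⟨fun hz => ⟨h.hom 0 1 z, ?_⟩, ?_⟩
  · have const_eq_zero : (constChainMap T x).f 0 z = 0 := by
      refine (LinearMap.congr_fun (constChainMap_f_zero T x) z).trans ?_
      rw [LinearMap.comp_apply, hz, map_zero]
    have homotopy_zero := h.comm 0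
    rw [Homotopy.dNext_zero_chainComplex, zero_add, Homotopy.prevD_chainComplex] at homotopy_zero
    refine Eq.symm ((ConcreteCategory.congr_hom homotopy_zero z).trans ?_)
    exact (congrArg (_ + ·) const_eq_zero).trans (add_zero _)
  · rintro ⟨y, rfl⟩
    exact LinearMap.congr_fun degree_comp_d y

end SingularChains

section BredonResolution

open Simplicial

variable {G : Type} [Group G] {H : Subgroup G} {K : OrbitCat G}

theorem nonempty_hom_of_fixedPoints (x : MulAction.fixedPoints K.sub (InfiniteJoin (G ⧸ H))) :
    Nonempty (K ⟶ (⟨H⟩ : OrbitCat G)) := by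
  obtain ⟨⟨i, s⟩, hs⟩ : ∃ v, x.1.weight v ≠ 0 := by
    by_contra! weight_eq_zero
    have sum_eq_one := x.1.sum_eq_one
    rw [show x.1.weight = 0 from Finsupp.ext weight_eq_zero] at sum_eq_one
    exact zero_ne_one sum_eq_one
  refine ⟨OrbitCat.homMk (L := ⟨H⟩) s fun k hk => x.1.unique i _ _ ?_ hs⟩
  have smul_eq : k • x.1 = x.1 := x.2 ⟨k, hk⟩
  rw [← smul_eq, InfiniteJoin.weight_smul, inv_smul_smul]
  exact hs

theorem nonempty_hom_of_fixedSimplices {n : ℕ}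
    (s : fixedSimplices (InfiniteJoin (G ⧸ H)) n K) : Nonempty (K ⟶ (⟨H⟩ : OrbitCat G)) :=
  nonempty_hom_of_fixedPoints
    (s.down.hom (Classical.arbitrary (SimplexCategory.toTop.{0}.obj ⦋n⦌)))

theorem contractibleSpace_of_hom (φ : K ⟶ (⟨H⟩ : OrbitCat G)) :
    ContractibleSpace ((fixedPointsFunctor (InfiniteJoin (G ⧸ H))).obj (op K)) :=
  InfiniteJoin.contractibleSpace_fixedPoints K.sub (s₀ := OrbitCat.imageOne φ)
    fun _ hk => OrbitCat.smul_imageOne φ hk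

theorem subsingleton_bredonChains (hK : IsEmpty (K ⟶ (⟨H⟩ : OrbitCat G))) (n : ℕ) :
    Subsingleton (((bredonChains (InfiniteJoin (G ⧸ H))).X n).obj (op K)) := by
  have : IsEmpty (fixedSimplices (InfiniteJoin (G ⧸ H)) n K) :=
    ⟨fun s => (nonempty_hom_of_fixedSimplices s).elim hK.false⟩
  exact (chainBasis (TopCat.toSSet.obj ((fixedPointsFunctor
    (InfiniteJoin (G ⧸ H))).obj (op K))) n).repr.injective.subsingleton

theorem orbitSupport.subsingleton_obj (hK : IsEmpty (K ⟶ (⟨H⟩ : OrbitCat G))) :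
    Subsingleton ((orbitSupport H).obj (op K)) := by
  have : IsEmpty (PLift (Nonempty (K ⟶ (⟨H⟩ : OrbitCat G)))) := ⟨fun h => h.down.elim hK.false⟩
  exact inferInstanceAs (Subsingleton (PLift (Nonempty (K ⟶ (⟨H⟩ : OrbitCat G))) →₀ ℤ))

theorem orbitSupport.bijective_toSpanSingleton (hK : Nonempty (K ⟶ (⟨H⟩ : OrbitCat G))) :
    Function.Bijective (LinearMap.toSpanSingleton ℤ ((orbitSupport H).obj (op K))
      (orbitSupport.one hK)) := by
  have toSpanSingleton_eq (k : ℤ) :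
      LinearMap.toSpanSingleton ℤ ((orbitSupport H).obj (op K)) (orbitSupport.one hK) k =
        (Finsupp.uniqueLinearEquiv ℤ ℤ (PLift.up hK)).symm k :=
    (Finsupp.smul_single_one _ k).trans rfl
  rw [funext toSpanSingleton_eq]
  exact LinearEquiv.bijective _

variable (H)

/-- The augmentation of the Bredon chains of the infinite join of `G/H`. -/
def bredonAug : (bredonChains (G := G) (InfiniteJoin (G ⧸ H))).X 0 ⟶ orbitSupport H :=
  (bredonChainsBasis _ 0).desc fun _ => orbitSupport.one (nonempty_hom_of_fixedSimplices
    ((fixedSimplicesEquiv _ 0 _).symm ⟨Quotient.out _, fun k => k.2⟩))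

variable {H}

theorem bredonAug_app_chainMk (s : fixedSimplices (InfiniteJoin (G ⧸ H)) 0 K) :
    (bredonAug H).app (op K) (chainMk s) =
      orbitSupport.one (nonempty_hom_of_fixedSimplices s) := by
  let B := bredonChainsBasis (G := G) (InfiniteJoin (G ⧸ H)) 0
  obtain ⟨⟨a, φ⟩, basis_eq⟩ : ∃ x, B.basis K x = chainMk s :=
    ⟨_, (chainBasis_reindex_apply _ _ _ _).trans (congrArg chainMk (Equiv.symm_apply_apply _ s))⟩
  refine (congrArg ((bredonAug H).app (op K)) basis_eq.symm).trans ?_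
  exact (B.desc_app_basis _ a φ).trans (orbitSupport.map_one φ _ _)

theorem bredonAug_app_hom (hK : Nonempty (K ⟶ (⟨H⟩ : OrbitCat G))) :
    ((bredonAug H).app (op K)).hom =
      (LinearMap.toSpanSingleton ℤ _ (orbitSupport.one hK)).comp (zeroChainDegree _) := by
  refine (chainBasis (TopCat.toSSet.obj ((fixedPointsFunctor
    (InfiniteJoin (G ⧸ H))).obj (op K))) 0).ext fun s => ?_
  rw [chainBasis_apply, LinearMap.comp_apply, zeroChainDegree_chainMk]
  exact (bredonAug_app_chainMk s).trans (LinearMap.toSpanSingleton_apply_one ℤ _ _).symm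

theorem bredonAug_surjective (K : (OrbitCat G)ᵒᵖ) :
    Function.Surjective ((bredonAug H).app K) := by
  rcases isEmpty_or_nonempty (K.unop ⟶ (⟨H⟩ : OrbitCat G)) with hK | hK
  · have := orbitSupport.subsingleton_obj hK
    exact fun z => ⟨0, this.elim _ _⟩
  · have := contractibleSpace_of_hom hK.some
    have h := (orbitSupport.bijective_toSpanSingleton hK).2.comp (zeroChainDegree_surjective
      ((fixedPointsFunctor (InfiniteJoin (G ⧸ H))).obj K))
    rw [← LinearMap.coe_comp, ← bredonAug_app_hom hK] at h
    exact h

theorem bredonChains_exact_zero (K : (OrbitCat G)ᵒᵖ) :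
    Function.Exact (((bredonChains (G := G) (InfiniteJoin (G ⧸ H))).d 1 0).app K)
      ((bredonAug H).app K) := by
  rcases isEmpty_or_nonempty (K.unop ⟶ (⟨H⟩ : OrbitCat G)) with hK | hK
  · have := subsingleton_bredonChains hK 0
    have := orbitSupport.subsingleton_obj hK
    exact fun z => iff_of_true (Subsingleton.elim _ _) ⟨0, Subsingleton.elim _ _⟩
  · have := contractibleSpace_of_hom hK.some
    have exact_degree := singularChains_exact_zeroChainDegree
      ((fixedPointsFunctor (InfiniteJoin (G ⧸ H))).obj K)
    have h := (orbitSupport.bijective_toSpanSingleton hK).1.comp_exact_iff_exact.mpr exact_degree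
    rw [← bredonAug_app_hom hK] at h
    exact h

theorem bredonChains_exact_succ (n : ℕ) (K : (OrbitCat G)ᵒᵖ) :
    Function.Exact (((bredonChains (G := G) (InfiniteJoin (G ⧸ H))).d (n + 2) (n + 1)).app K)
      (((bredonChains (G := G) (InfiniteJoin (G ⧸ H))).d (n + 1) n).app K) := by
  rcases isEmpty_or_nonempty (K.unop ⟶ (⟨H⟩ : OrbitCat G)) with hK | hK
  · have := subsingleton_bredonChains hK (n + 1)
    have := subsingleton_bredonChains hK n
    exact fun z => iff_of_true (Subsingleton.elim _ _) ⟨0, Subsingleton.elim _ _⟩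
  · have := contractibleSpace_of_hom hK.some
    exact singularChains_exact_succ _ n

variable (H)

/-- The Bredon chains of the infinite join of `G/H`, as a projective resolution. -/
def bredonResolution : ProjectiveResolution (orbitSupport H) :=
  projectiveResolutionOfExact (bredonChains (G := G) (InfiniteJoin (G ⧸ H)))
    (bredonChains_projective _) (bredonAug H) bredonAug_surjective bredonChains_exact_zero
    bredonChains_exact_succ

end BredonResolution

/-! ### Malnormal subgroups -/

section Malnormal

variable {G : Type} [Group G]

/-- A subgroup `H` is malnormal if it meets its conjugate `g H g⁻¹` trivially for all `g ∉ H`. -/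
def IsMalnormal (H : Subgroup G) : Prop :=
  ∀ g ∉ H, ∀ h ∈ H, g⁻¹ * h * g ∈ H → h = 1

variable {H : Subgroup G}

theorem OrbitCat.exists_ne_one_of_isEmpty_hom_free {K : OrbitCat G}
    (hK : IsEmpty (K ⟶ OrbitCat.free G)) : ∃ k ∈ K.sub, k ≠ 1 := by
  by_contra! eq_one
  exact hK.false (homMk ((1 : G) : G ⧸ ⊥) fun k hk => by rw [eq_one k hk, one_smul])

theorem inv_mul_mul_eq_one_iff {g k : G} : g⁻¹ * k * g = 1 ↔ k = 1 := by
  simpa only [inv_inv] using conj_eq_one_iff (a := g⁻¹) (b := k)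

theorem IsMalnormal.eq_of_smul_eq (hH : IsMalnormal H) {k : G} (hk : k ≠ 1) {x y : G ⧸ H}
    (hx : k • x = x) (hy : k • y = y) : x = y := by
  have conj_mem {g : G} (hg : k • (g : G ⧸ H) = g) : g⁻¹ * k * g ∈ H := by
    rw [mul_assoc]
    exact QuotientGroup.eq.mp hg.symm
  obtain ⟨g, rfl⟩ := QuotientGroup.mk_surjective x
  obtain ⟨g', rfl⟩ := QuotientGroup.mk_surjective y
  by_contra hne
  have conj_eq_one : g⁻¹ * k * g = 1 := by
    refine hH (g⁻¹ * g') (fun h => hne (QuotientGroup.eq.mpr h)) _ (conj_mem hx) ?_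
    rw [show (g⁻¹ * g')⁻¹ * (g⁻¹ * k * g) * (g⁻¹ * g') = g'⁻¹ * k * g' by group]
    exact conj_mem hy
  exact hk (inv_mul_mul_eq_one_iff.mp conj_eq_one)

theorem IsMalnormal.subsingleton_hom (hH : IsMalnormal H) (K : OrbitCat G)
    (hK : IsEmpty (K ⟶ OrbitCat.free G)) : Subsingleton (K ⟶ (⟨H⟩ : OrbitCat G)) := by
  obtain ⟨k, hk, hk1⟩ := OrbitCat.exists_ne_one_of_isEmpty_hom_free hK
  exact ⟨fun φ ψ => OrbitCat.imageOne_injective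
    (hH.eq_of_smul_eq hk1 (OrbitCat.smul_imageOne φ hk) (OrbitCat.smul_imageOne ψ hk))⟩

/-- In degrees at least two, the Bredon cohomology of the infinite join of `G/H` is the cohomology
of `G` relative to `H`. -/
def IsMalnormal.bredonIso (hH : IsMalnormal H) (M : CoeffSystem G) (i : ℕ) :
    relCohomology H M (i + 2) ≅ bredonCohomology (InfiniteJoin (G ⧸ H)) M (i + 2) :=
  relCohomology.extIso M hH.subsingleton_hom (bredonResolution H) i

theorem mainTheorem6_general (hH : IsMalnormal H) (M : CoeffSystem G) :
    (∃ (α : ∀ i : ℕ,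
          bredonCohomology (InfiniteJoin (G ⧸ H)) M (i + 2) ⟶ groupCohomology M.atE (i + 2))
        (δ : ∀ i : ℕ, groupCohomology (Rep.res H.subtype M.atE) (i + 1) ⟶
          bredonCohomology (InfiniteJoin (G ⧸ H)) M (i + 2))
        (A : ModuleCat.{0} ℤ)
        (δ₀ : groupCohomology (Rep.res H.subtype M.atE) 0 ⟶ A)
        (α₁ : A ⟶ groupCohomology M.atE 1)
        (q : A ⟶ bredonCohomology (InfiniteJoin (G ⧸ H)) M 1),
        (∀ i : ℕ, Function.Exact (α i).hom (groupCohomologyRes H M.atE (i + 2)).hom) ∧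
        (∀ i : ℕ, Function.Exact (groupCohomologyRes H M.atE (i + 2)).hom (δ (i + 1)).hom) ∧
        (∀ i : ℕ, Function.Exact (δ i).hom (α i).hom) ∧
        Function.Injective (groupCohomologyRes H M.atE 0).hom ∧
        Function.Exact (groupCohomologyRes H M.atE 0).hom δ₀.hom ∧
        Function.Exact δ₀.hom α₁.hom ∧
        Function.Exact α₁.hom (groupCohomologyRes H M.atE 1).hom ∧
        Function.Exact (groupCohomologyRes H M.atE 1).hom (δ 0).hom ∧
        Function.Surjective q.hom) ∧
    (∀ [Finite G] (m : ℕ), Nat.Coprime m (Nat.card G) → IsMProfinite m M.atE →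
      ∀ i : ℕ, 1 < i → Subsingleton (bredonCohomology (InfiniteJoin (G ⧸ H)) M i)) := by
  open relCohomology in
  let e (i : ℕ) := (hH.bredonIso M i).toLinearEquiv
  have exact_res_δ_comp (i : ℕ) : Function.Exact (groupCohomologyRes H M.atE (i + 1)).hom
      (δ H M (i + 1) ≫ (hH.bredonIso M i).hom).hom :=
    (LinearEquiv.postcomp_exact_iff_exact (e := e i)).mpr (exact_res_δ H M (i + 1))
  refine ⟨⟨fun i => (hH.bredonIso M i).inv ≫ toGroup H M (i + 2),
    fun i => δ H M (i + 1) ≫ (hH.bredonIso M i).hom, relCohomology H M 1, δ H M 0,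
    toGroup H M 1, toExt M hH.subsingleton_hom (bredonResolution H) 1,
    fun i => (LinearEquiv.precomp_exact_iff_exact (e := (e i).symm)).mpr
      (exact_toGroup_res H M (i + 2)),
    fun i => exact_res_δ_comp (i + 1),
    fun i => (LinearEquiv.conj_exact_iff_exact _ _ (e i)).mpr (exact_δ_toGroup H M (i + 1)),
    groupCohomologyRes_zero_injective H M, exact_res_δ H M 0, exact_δ_toGroup H M 0,
    exact_toGroup_res H M 1, exact_res_δ_comp 0,
    toExt_one_surjective M hH.subsingleton_hom (bredonResolution H)⟩, ?_⟩
  intro _ m hm hM i hi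
  obtain ⟨i, rfl⟩ := Nat.exists_eq_add_of_le' hi
  have := subsingleton_of_bijective_nsmul H (hM.bijective_nsmul hm) i
  exact (e i).symm.injective.subsingleton

end Malnormal

section Dihedral

variable {n : ℕ}

theorem mem_reflectionSubgroup_iff {g : DihedralGroup n} :
    g ∈ reflectionSubgroup n ↔ g = 1 ∨ g = DihedralGroup.sr 0 := by
  have sq_eq_one : (DihedralGroup.sr 0 : DihedralGroup n) ^ (2 : ℤ) = 1 := by
    rw [zpow_two, DihedralGroup.sr_mul_self]
  constructor
  · intro h
    obtain ⟨k, rfl⟩ := Subgroup.mem_zpowers_iff.mp h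
    rcases Int.even_or_odd' k with ⟨l, rfl | rfl⟩
    · exact .inl (by rw [zpow_mul, sq_eq_one, one_zpow])
    · exact .inr (by rw [zpow_add, zpow_mul, sq_eq_one, one_zpow, one_mul, zpow_one])
  · rintro (rfl | rfl)
    exacts [one_mem _, Subgroup.mem_zpowers _]

theorem mem_reflectionSubgroup_of_commute (hn : Odd n) {g : DihedralGroup n}
    (h : Commute g (DihedralGroup.sr 0)) : g ∈ reflectionSubgroup n := by
  have eq_zero {i : ZMod n} (hi : i + i = 0) : i = 0 :=
    (ZMod.add_self_eq_zero_iff_eq_zero hn).mp hi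
  have h_eq := h.eq
  rw [mem_reflectionSubgroup_iff]
  cases g with
  | r i =>
    rw [DihedralGroup.r_mul_sr, DihedralGroup.sr_mul_r, DihedralGroup.sr.injEq] at h_eq
    exact .inl (by rw [eq_zero (i := i) (by linear_combination -h_eq), DihedralGroup.r_zero])
  | sr i =>
    rw [DihedralGroup.sr_mul_sr, DihedralGroup.sr_mul_sr, DihedralGroup.r.injEq] at h_eq
    exact .inr (by rw [eq_zero (i := i) (by linear_combination -h_eq)])

theorem isMalnormal_reflectionSubgroup (hn : Odd n) : IsMalnormal (reflectionSubgroup n) := by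
  intro g hg h hh hconj
  by_contra h_ne_one
  obtain rfl := (mem_reflectionSubgroup_iff.mp hh).resolve_left h_ne_one
  have conj_eq := (mem_reflectionSubgroup_iff.mp hconj).resolve_left
    (mt inv_mul_mul_eq_one_iff.mp h_ne_one)
  rw [mul_assoc, inv_mul_eq_iff_eq_mul] at conj_eq
  exact hg (mem_reflectionSubgroup_of_commute hn conj_eq.symm)

end Dihedral

end

theorem mainTheorem6 (n : ℕ) (hn : Odd n) (M : CoeffSystem (DihedralGroup n)) :
    (∃ (α : ∀ i : ℕ, bredonCohomology (EHD n) M (i + 2) ⟶ groupCohomology M.atE (i + 2))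
        (δ : ∀ i : ℕ,
          groupCohomology (Rep.res (reflectionSubgroup n).subtype M.atE) (i + 1) ⟶
            bredonCohomology (EHD n) M (i + 2))
        (A : ModuleCat.{0} ℤ)
        (δ₀ : groupCohomology (Rep.res (reflectionSubgroup n).subtype M.atE) 0 ⟶ A)
        (α₁ : A ⟶ groupCohomology M.atE 1)
        (q : A ⟶ bredonCohomology (EHD n) M 1),
        -- the long exact sequence in degrees at least two
        (∀ i : ℕ, Function.Exact (α i).hom
          (groupCohomologyRes (reflectionSubgroup n) M.atE (i + 2)).hom) ∧
        (∀ i : ℕ, Function.Exact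
          (groupCohomologyRes (reflectionSubgroup n) M.atE (i + 2)).hom (δ (i + 1)).hom) ∧
        (∀ i : ℕ, Function.Exact (δ i).hom (α i).hom) ∧
        -- its extension to low degrees
        Function.Injective (groupCohomologyRes (reflectionSubgroup n) M.atE 0).hom ∧
        Function.Exact (groupCohomologyRes (reflectionSubgroup n) M.atE 0).hom δ₀.hom ∧
        Function.Exact δ₀.hom α₁.hom ∧
        Function.Exact α₁.hom (groupCohomologyRes (reflectionSubgroup n) M.atE 1).hom ∧
        Function.Exact (groupCohomologyRes (reflectionSubgroup n) M.atE 1).hom (δ 0).hom ∧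
        Function.Surjective q.hom) ∧
    (∀ m : ℕ, Nat.Coprime m (2 * n) → IsMProfinite m M.atE →
      ∀ i : ℕ, 1 < i → Subsingleton (bredonCohomology (EHD n) M i)) := by
  have : NeZero n := ⟨hn.pos.ne'⟩
  obtain ⟨exact_seq, vanishing⟩ := mainTheorem6_general (isMalnormal_reflectionSubgroup hn) M
  exact ⟨exact_seq, fun m hm => vanishing m (by rwa [DihedralGroup.nat_card])⟩
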